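/- Let $d$ be an integer with $4\le d\le 7$. For $t>0$, consider the hyperplanes $H$ of $\mathbb{R}^d$ at distance $t$ from the center of the hypercube $[0,1]^d$; these are the sets $H=H_a=\{x\in\mathbb{R}^d : a\cdot x=\tfrac12\sum_{i=1}^d a_i-t\}$, where $a$ ranges over the unit sphere $\mathbb{S}^{d-1}$. Let $V_t(a)$ be the $(d-1)$-dimensional volume of $H_a\cap[0,1]^d$. A diagonal of $[0,1]^d$ is a line segment joining two opposite vertices. We say that the section volume is strictly locally maximal (resp. minimal) at the diagonals for $t$ if, for every $a\in\mathbb{S}^{d-1}$ parallel to a diagonal of $[0,1]^d$ (that is, whenever $H_a$ is orthogonal to a diagonal), the function $V_t$ on $\mathbb{S}^{d-1}$ has a strict local maximum (resp. minimum) at $a$. Then there exist two real numbers $\rho_d^+$ and $\rho_d^-$ with $0<\rho_d^+<\rho_d^-<d/2$ such that: - if $t\in\left(0,\frac{\sqrt d}{2}-\frac{\rho_d^-}{\sqrt d}\right)\cup\left(\frac{\sqrt d}{2}-\frac{\rho_d^+}{\sqrt d},\frac{\sqrt d}{2}\right)$, then the section volume is strictly locally maximal at the diagonals for $t$; - if $t\in\left(\frac{\sqrt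 d}{2}-\frac{\rho_d^-}{\sqrt d},\frac{\sqrt d}{2}-\frac{\rho_d^+}{\sqrt d}\right)$, then the section volume is strictly locally minimal at the diagonals for $t$. -/

import Mathlib

open MeasureTheory Topology

namespace HypercubeSection

/-- The hypercube `[0,1]^d` in Euclidean space. -/
def cube (d : ℕ) : Set (EuclideanSpace ℝ (Fin d)) :=
  {x | ∀ i, x i ∈ Set.Icc (0 : ℝ) 1}

/-- The hyperplane `a · x = σ(a)/2 - t`, where `σ(a)` is the sum of the coordinates of `a`.
For a unit vector `a` and `t ≥ 0`, it is the hyperplane normal to `a` at distance `t` from the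
center `(1/2, …, 1/2)` of the cube (on the side of `-a`); every hyperplane at distance `t` from
the center is of this form. -/
def hyperplane (d : ℕ) (t : ℝ) (a : EuclideanSpace ℝ (Fin d)) :
    Set (EuclideanSpace ℝ (Fin d)) :=
  {x | ∑ i, a i * x i = (∑ i, a i) / 2 - t}

/-- The `(d-1)`-dimensional volume of the section of the cube by that hyperplane
(`μHE[d - 1]` is the Hausdorff measure normalised to agree with Lebesgue measure). -/
noncomputable def sectionVolume (d : ℕ) (t : ℝ) (a : EuclideanSpace ℝ (Fin d)) : ENNReal :=
  μHE[d - 1] (hyperplane d t a ∩ cube d)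

/-- `v` and `w` are opposite vertices of `[0,1]^d`, i.e. the endpoints of a diagonal. -/
def OppositeVertices {d : ℕ} (v w : EuclideanSpace ℝ (Fin d)) : Prop :=
  ∀ i, (v i = 0 ∧ w i = 1) ∨ (v i = 1 ∧ w i = 0)

/-- `a` is parallel to a diagonal of `[0,1]^d`, i.e. the hyperplanes normal to `a` (when `a ≠ 0`)
are orthogonal to a diagonal. -/
def IsDiagonalDirection {d : ℕ} (a : EuclideanSpace ℝ (Fin d)) : Prop :=
  ∃ v w : EuclideanSpace ℝ (Fin d), OppositeVertices v w ∧ ∃ c : ℝ, a = c • (w - v)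

/-- `f` restricted to `S` has a strict local maximum at `a`: `f x < f a` for all `x ∈ S`
with `x ≠ a` close enough to `a`. -/
def IsStrictLocalMaxOn {X Y : Type*} [TopologicalSpace X] [Preorder Y]
    (f : X → Y) (S : Set X) (a : X) : Prop :=
  a ∈ S ∧ ∀ᶠ x in 𝓝[S \ {a}] a, f x < f a

/-- `f` restricted to `S` has a strict local minimum at `a`: `f a < f x` for all `x ∈ S`
with `x ≠ a` close enough to `a`. -/
def IsStrictLocalMinOn {X Y : Type*} [TopologicalSpace X] [Preorder Y]
    (f : X → Y) (S : Set X) (a : X) : Prop :=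
  a ∈ S ∧ ∀ᶠ x in 𝓝[S \ {a}] a, f a < f x

/-- Among the hyperplanes at distance `t` from the center of `[0,1]^d` (parametrised by their
unit normal vector), the section volume is strictly locally maximal at each hyperplane that is
orthogonal to a diagonal. -/
def StrictLocalMaxAtDiagonals (d : ℕ) (t : ℝ) : Prop :=
  ∀ a : EuclideanSpace ℝ (Fin d), ‖a‖ = 1 → IsDiagonalDirection a →
    IsStrictLocalMaxOn (sectionVolume d t) (Metric.sphere 0 1) a

/-- Same as `StrictLocalMaxAtDiagonals`, for strict local minimality. -/
def StrictLocalMinAtDiagonals (d : ℕ) (t : ℝ) : Prop :=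
  ∀ a : EuclideanSpace ℝ (Fin d), ‖a‖ = 1 → IsDiagonalDirection a →
    IsStrictLocalMinOn (sectionVolume d t) (Metric.sphere 0 1) a

end HypercubeSection

namespace HypercubeSection

/-- The truncated power `x₊ⁿ`, with the convention that `x₊⁰` is the indicator of `[0, ∞)`. -/
noncomputable def posPow (n : ℕ) (x : ℝ) : ℝ := if 0 ≤ x then x ^ n else 0

theorem posPow_of_nonneg (n : ℕ) {x : ℝ} (hx : 0 ≤ x) : posPow n x = x ^ n := if_pos hx

theorem posPow_of_neg (n : ℕ) {x : ℝ} (hx : x < 0) : posPow n x = 0 := if_neg (not_le.2 hx)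

theorem posPow_of_nonpos {n : ℕ} (hn : n ≠ 0) {x : ℝ} (hx : x ≤ 0) : posPow n x = 0 := by
  rcases hx.lt_or_eq with h | rfl
  · exact posPow_of_neg n h
  · simp [posPow, hn]

theorem monotone_posPow (n : ℕ) : Monotone (posPow n) := by
  intro x y hxy
  unfold posPow
  split_ifs with hx hy hy
  · gcongr
  · exact absurd (hx.trans hxy) hy
  · positivity
  · exact le_rfl

theorem posPow_eq_max_pow {n : ℕ} (hn : n ≠ 0) (x : ℝ) : posPow n x = (max x 0) ^ n := by
  rcases le_total 0 x with h | h
  · rw [posPow_of_nonneg n h, max_eq_left h]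
  · rw [posPow_of_nonpos hn h, max_eq_right h, zero_pow hn]

theorem continuous_posPow {n : ℕ} (hn : n ≠ 0) : Continuous (posPow n) := by
  rw [funext (posPow_eq_max_pow hn)]
  fun_prop

theorem posPow_mul (n : ℕ) {r : ℝ} (hr : 0 < r) (x : ℝ) :
    posPow n (r * x) = r ^ n * posPow n x := by
  unfold posPow
  simp only [mul_nonneg_iff_of_pos_left hr, mul_pow]
  split_ifs <;> simp

theorem hasDerivAt_posPow_succ (n : ℕ) {x : ℝ} (hx : x ≠ 0) :
    HasDerivAt (posPow (n + 1)) ((n + 1) * posPow n x) x := by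
  rcases hx.lt_or_gt with h | h
  · rw [posPow_of_neg n h, mul_zero]
    refine (hasDerivAt_const x (0 : ℝ)).congr_of_eventuallyEq ?_
    filter_upwards [gt_mem_nhds h] with y hy using posPow_of_neg _ hy
  · rw [posPow_of_nonneg n h.le]
    have := hasDerivAt_pow (n + 1) x
    simp only [Nat.cast_add, Nat.cast_one, Nat.add_sub_cancel] at this
    refine this.congr_of_eventuallyEq ?_
    filter_upwards [lt_mem_nhds h] with y hy using posPow_of_nonneg _ hy.le

theorem intervalIntegrable_posPow (n : ℕ) (s a : ℝ) (ha : 0 < a) (u v : ℝ) :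
    IntervalIntegrable (fun x => posPow n (s - a * x)) volume u v := by
  refine Antitone.intervalIntegrable fun x y hxy => monotone_posPow n ?_
  gcongr

theorem integral_posPow (n : ℕ) (s a : ℝ) (ha : 0 < a) :
    ∫ x in (0 : ℝ)..1, posPow n (s - a * x) =
      (posPow (n + 1) s - posPow (n + 1) (s - a)) / ((n + 1) * a) := by
  have hn : ((n : ℝ) + 1) ≠ 0 := by positivity
  rw [integral_eq_of_hasDerivAt_off_countable
    (fun x => -posPow (n + 1) (s - a * x) / ((n + 1) * a)) (fun x => posPow n (s - a * x))
    (Set.countable_singleton (s / a))]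
  · simp; ring
  · have := continuous_posPow (Nat.succ_ne_zero n)
    exact Continuous.continuousOn (by fun_prop)
  · rintro x ⟨-, hx⟩
    have hx' : s - a * x ≠ 0 := by
      intro h
      apply hx
      rw [Set.mem_singleton_iff, eq_div_iff ha.ne']
      linarith
    have h1 : HasDerivAt (fun x : ℝ => s - a * x) (-a) x := by
      simpa using ((hasDerivAt_id x).const_mul a).const_sub s
    have h2 := (((hasDerivAt_posPow_succ n hx').comp x h1).neg).div_const ((n + 1) * a)
    refine h2.congr_deriv ?_
    field_simp
  · exact intervalIntegrable_posPow n s a ha 0 1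

theorem sum_finset_fin_succ {M : Type*} [AddCommMonoid M] {n : ℕ}
    (F : Finset (Fin (n + 1)) → M) :
    ∑ T, F T = ∑ T : Finset (Fin n), (F (T.map (Fin.succEmb n)) +
      F (insert 0 (T.map (Fin.succEmb n)))) := by
  have h0 : (Finset.univ : Finset (Finset (Fin (n + 1)))) =
      (insert 0 (Finset.univ.map (Fin.succEmb n))).powerset := by
    ext T
    simp only [Finset.mem_univ, Finset.mem_powerset, true_iff]
    intro i _
    refine Fin.cases ?_ (fun j => ?_) i <;> simp
  have h1 : (0 : Fin (n + 1)) ∉ Finset.univ.map (Fin.succEmb n) := by simp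
  have h2 : (Finset.univ.map (Fin.succEmb n)).powerset =
      Finset.univ.map (Finset.mapEmbedding (Fin.succEmb n)).toEmbedding := by
    ext T
    simp only [Finset.mem_powerset, Finset.mem_map, Finset.mem_univ, true_and]
    rw [Finset.subset_map_iff]
    simp [Finset.mapEmbedding_apply, eq_comm]
  rw [h0, Finset.sum_powerset_insert h1, ← Finset.sum_add_distrib, h2, Finset.sum_map]
  rfl

/-- The signed sum over vertices of the box with edge lengths `a`. -/
noncomputable def altSum {n : ℕ} (f : ℝ → ℝ) (a : Fin n → ℝ) (s : ℝ) : ℝ :=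
  ∑ T : Finset (Fin n), (-1) ^ T.card * f (s - ∑ i ∈ T, a i)

theorem altSum_succ {n : ℕ} (f : ℝ → ℝ) (a : Fin (n + 1) → ℝ) (s : ℝ) :
    altSum f a s = altSum f (fun i => a i.succ) s - altSum f (fun i => a i.succ) (s - a 0) := by
  unfold altSum
  rw [sum_finset_fin_succ, ← Finset.sum_sub_distrib]
  refine Finset.sum_congr rfl fun T _ => ?_
  have h1 : (0 : Fin (n + 1)) ∉ T.map (Fin.succEmb n) := by simp
  rw [Finset.card_insert_of_notMem h1, Finset.sum_insert h1, Finset.card_map, Finset.sum_map]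
  simp only [Fin.coe_succEmb, pow_succ, sub_sub]
  ring

/-- The part of the unit cube on one side of a hyperplane. -/
def halfCube {n : ℕ} (a : Fin n → ℝ) (s : ℝ) : Set (Fin n → ℝ) :=
  {y | (∀ i, y i ∈ Set.Icc (0 : ℝ) 1) ∧ ∑ i, a i * y i ≤ s}

theorem halfCube_subset {n : ℕ} (a : Fin n → ℝ) (s : ℝ) : halfCube a s ⊆ Set.Icc 0 1 :=
  fun _ hy => ⟨fun i => (hy.1 i).1, fun i => (hy.1 i).2⟩

theorem volume_halfCube_ne_top {n : ℕ} (a : Fin n → ℝ) (s : ℝ) : volume (halfCube a s) ≠ ⊤ :=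
  ((measure_mono (halfCube_subset a s)).trans_lt isCompact_Icc.measure_lt_top).ne

theorem isClosed_halfCube {n : ℕ} (a : Fin n → ℝ) (s : ℝ) : IsClosed (halfCube a s) := by
  have : halfCube a s = Set.Icc 0 1 ∩ {y | ∑ i, a i * y i ≤ s} := by
    ext y
    simp [halfCube, Pi.le_def, forall_and]
  rw [this]
  exact isClosed_Icc.inter (isClosed_le (by fun_prop) continuous_const)

theorem volume_halfCube_succ {n : ℕ} (a : Fin (n + 1) → ℝ) (s : ℝ) :
    volume (halfCube a s) =
      ∫⁻ x in Set.Icc (0 : ℝ) 1, volume (halfCube (fun i => a i.succ) (s - a 0 * x)) := by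
  have hm := volume_preserving_piFinSuccAbove (fun _ : Fin (n + 1) => ℝ) 0
  have hS : MeasurableSet (halfCube a s) := (isClosed_halfCube a s).measurableSet
  rw [← hm.symm.measure_preimage hS.nullMeasurableSet, Measure.volume_eq_prod,
    Measure.prod_apply (hm.symm.measurable hS), ← lintegral_indicator measurableSet_Icc]
  refine lintegral_congr fun x => ?_
  by_cases hx : x ∈ Set.Icc (0 : ℝ) 1
  · rw [Set.indicator_of_mem hx]
    congr 1
    ext y
    simp only [halfCube, Set.mem_preimage, Set.mem_ofPred_eq, Fin.forall_fin_succ,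
      MeasurableEquiv.piFinSuccAbove_symm_apply, Fin.insertNthEquiv_apply, Fin.insertNth_zero',
      Fin.cons_zero, Fin.cons_succ, Fin.sum_univ_succ, hx, true_and]
    refine and_congr_right fun _ => ?_
    constructor <;> intro h <;> linarith
  · rw [Set.indicator_of_notMem hx]
    convert measure_empty (μ := volume)
    ext y
    simp only [halfCube, Set.mem_preimage, Set.mem_ofPred_eq, Fin.forall_fin_succ,
      MeasurableEquiv.piFinSuccAbove_symm_apply, Fin.insertNthEquiv_apply, Fin.insertNth_zero',
      Fin.cons_zero, hx, false_and, Set.mem_empty_iff_false]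

theorem volume_real_halfCube {n : ℕ} (a : Fin n → ℝ) (ha : ∀ i, 0 < a i) (s : ℝ) :
    (volume (halfCube a s)).toReal = altSum (posPow n) a s / (n.factorial * ∏ i, a i) := by
  induction n generalizing s with
  | zero =>
    have h1 : halfCube a s = if 0 ≤ s then Set.univ else ∅ := by
      ext y
      split_ifs with h <;> simp [halfCube, h]
    have h2 : (Finset.univ : Finset (Finset (Fin 0))) = {∅} := rfl
    have h3 : volume (Set.univ : Set (Fin 0 → ℝ)) = 1 := by
      rw [volume_pi, Measure.pi_of_empty _ 0]
      simp
    rw [h1]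
    unfold altSum
    rw [h2, Finset.sum_singleton]
    split_ifs with h
    · simp [posPow, h, h3]
    · simp [posPow, h]
  | succ n ih =>
    set a' : Fin n → ℝ := fun i => a i.succ with ha'
    have ih' := ih a' (fun i => ha i.succ)
    have hint : ∀ T : Finset (Fin n), IntervalIntegrable
        (fun x => (-1) ^ T.card * posPow n (s - a 0 * x - ∑ i ∈ T, a' i)) volume 0 1 := by
      intro T
      have := (intervalIntegrable_posPow n (s - ∑ i ∈ T, a' i) (a 0) (ha 0) 0 1).const_mul
        ((-1) ^ T.card)
      refine this.congr ?_
      intro x _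
      simp only [sub_right_comm s (∑ i ∈ T, a' i)]
    have hint2 : IntervalIntegrable
        (fun x => altSum (posPow n) a' (s - a 0 * x) / (n.factorial * ∏ i, a' i)) volume 0 1 := by
      refine IntervalIntegrable.div_const ?_ _
      have := IntervalIntegrable.sum (μ := volume) (a := 0) (b := 1) Finset.univ
        (f := fun T : Finset (Fin n) => fun x =>
          (-1) ^ T.card * posPow n (s - a 0 * x - ∑ i ∈ T, a' i)) (fun T _ => hint T)
      refine this.congr ?_
      intro x _
      simp [altSum, Finset.sum_apply]
    have hval : ∫ x in (0 : ℝ)..1, altSum (posPow n) a' (s - a 0 * x) =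
        (altSum (posPow (n + 1)) a' s - altSum (posPow (n + 1)) a' (s - a 0)) /
          ((n + 1) * a 0) := by
      unfold altSum
      rw [intervalIntegral.integral_finsetSum fun T _ => hint T, ← Finset.sum_sub_distrib,
        Finset.sum_div]
      refine Finset.sum_congr rfl fun T _ => ?_
      rw [intervalIntegral.integral_const_mul]
      simp only [sub_right_comm s _ (∑ i ∈ T, a' i)]
      rw [integral_posPow n _ _ (ha 0)]
      ring
    have hvol : volume (halfCube a s) =
        ENNReal.ofReal (∫ x in Set.Icc (0 : ℝ) 1, altSum (posPow n) a' (s - a 0 * x) /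
          (n.factorial * ∏ i, a' i)) := by
      rw [volume_halfCube_succ, ofReal_integral_eq_lintegral_ofReal]
      · refine lintegral_congr fun x => ?_
        rw [← ih', ENNReal.ofReal_toReal (volume_halfCube_ne_top _ _)]
      · exact (intervalIntegrable_iff_integrableOn_Icc_of_le zero_le_one).1 hint2
      · refine Filter.Eventually.of_forall fun x => ?_
        simp only [Pi.zero_apply, ← ih']
        exact ENNReal.toReal_nonneg
    have hI : ∫ x in Set.Icc (0 : ℝ) 1, altSum (posPow n) a' (s - a 0 * x) /
          (n.factorial * ∏ i, a' i) =
        altSum (posPow (n + 1)) a s / ((n + 1).factorial * ∏ i, a i) := by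
      rw [integral_Icc_eq_integral_Ioc, ← intervalIntegral.integral_of_le zero_le_one,
        intervalIntegral.integral_div, hval, altSum_succ, Fin.prod_univ_succ, Nat.factorial_succ,
        div_div]
      push_cast
      congr 1
      ring
    rw [hvol, hI, ENNReal.toReal_ofReal]
    rw [← hI]
    refine integral_nonneg fun x => ?_
    simp only [Pi.zero_apply, ← ih']
    exact ENNReal.toReal_nonneg

theorem volume_hyperplane_eq_zero {n : ℕ} (hn : n ≠ 0) (a : Fin n → ℝ) (ha : ∀ i, 0 < a i)
    (c : ℝ) : volume {y : Fin n → ℝ | ∑ i, a i * y i = c} = 0 := by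
  obtain ⟨i₀⟩ : Nonempty (Fin n) := ⟨⟨0, Nat.pos_of_ne_zero hn⟩⟩
  let f : (Fin n → ℝ) →ₗ[ℝ] ℝ := ∑ i, a i • LinearMap.proj i
  have hf : ∀ y, f y = ∑ i, a i * y i := fun y => by simp [f]
  let A : AffineSubspace ℝ (Fin n → ℝ) := (AffineSubspace.mk' c ⊥).comap f.toAffineMap
  have hA : (A : Set (Fin n → ℝ)) = {y | ∑ i, a i * y i = c} := by
    ext y
    simp [A, hf, AffineSubspace.mem_mk', sub_eq_zero]
  rw [← hA]
  refine Measure.addHaar_affineSubspace volume A fun h => ?_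
  have h1 : ∀ y : Fin n → ℝ, ∑ i, a i * y i = c := fun y => by
    have : y ∈ (A : Set (Fin n → ℝ)) := by rw [h]; trivial
    rwa [hA] at this
  have h2 := h1 0
  have h3 := h1 (Pi.single i₀ 1)
  simp [Pi.single_apply] at h2 h3
  exact (ha i₀).ne' (h3.trans h2.symm)

/-- The volume of a slab of the unit cube. -/
theorem volume_slab {n : ℕ} (hn : n ≠ 0) (a : Fin (n + 1) → ℝ) (ha : ∀ i, 0 < a i) (s : ℝ) :
    volume {y : Fin n → ℝ | (∀ i, y i ∈ Set.Icc (0 : ℝ) 1) ∧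
      (s - ∑ i, a (Fin.succ i) * y i) / a 0 ∈ Set.Icc (0 : ℝ) 1} ≠ ⊤ ∧
    (volume {y : Fin n → ℝ | (∀ i, y i ∈ Set.Icc (0 : ℝ) 1) ∧
      (s - ∑ i, a (Fin.succ i) * y i) / a 0 ∈ Set.Icc (0 : ℝ) 1}).toReal =
      altSum (posPow n) a s / (n.factorial * ∏ i : Fin n, a i.succ) := by
  set a' : Fin n → ℝ := fun i => a i.succ with ha'
  set S := {y : Fin n → ℝ | (∀ i, y i ∈ Set.Icc (0 : ℝ) 1) ∧
      (s - ∑ i, a (Fin.succ i) * y i) / a 0 ∈ Set.Icc (0 : ℝ) 1} with hS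
  have hsub : halfCube a' (s - a 0) ⊆ halfCube a' s := fun y hy =>
    ⟨hy.1, hy.2.trans (by linarith [ha 0])⟩
  have hmem : ∀ y, y ∈ S ↔ (∀ i, y i ∈ Set.Icc (0 : ℝ) 1) ∧ ∑ i, a' i * y i ≤ s ∧
      s - a 0 ≤ ∑ i, a' i * y i := by
    intro y
    simp only [hS, Set.mem_ofPred_eq]
    rw [Set.mem_Icc, le_div_iff₀ (ha 0), div_le_one (ha 0), zero_mul, sub_nonneg,
      sub_le_comm]
  have hae : S =ᵐ[volume] (halfCube a' s \ halfCube a' (s - a 0) : Set (Fin n → ℝ)) := by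
    have h0 := volume_hyperplane_eq_zero hn a' (fun i => ha i.succ) (s - a 0)
    have h0' : ∀ᵐ y : Fin n → ℝ, ∑ i, a' i * y i ≠ s - a 0 := by
      simpa [ae_iff] using h0
    filter_upwards [h0'] with y hy
    refine propext ((hmem y).trans ?_)
    constructor
    · rintro ⟨h1, h2, h3⟩
      exact ⟨⟨h1, h2⟩, fun h => hy (le_antisymm h.2 h3)⟩
    · rintro ⟨⟨h1, h2⟩, h3⟩
      exact ⟨h1, h2, le_of_not_ge fun h => h3 ⟨h1, h⟩⟩
  rw [measure_congr hae, measure_sdiff hsub (isClosed_halfCube _ _).measurableSet.nullMeasurableSet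
    (volume_halfCube_ne_top _ _)]
  refine ⟨ENNReal.sub_ne_top (volume_halfCube_ne_top _ _), ?_⟩
  rw [ENNReal.toReal_sub_of_le (measure_mono hsub) (volume_halfCube_ne_top _ _),
    volume_real_halfCube a' (fun i => ha i.succ), volume_real_halfCube a' (fun i => ha i.succ),
    altSum_succ, sub_div]

/-- In an orthogonal matrix, complementary minors agree up to sign: here, the minor obtained by
deleting the first row and column. -/
theorem abs_det_minor_of_orthonormalBasis {n : ℕ}
    (e : OrthonormalBasis (Fin (n + 1)) ℝ (EuclideanSpace ℝ (Fin (n + 1)))) :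
    |(Matrix.of fun j k : Fin n => e k.succ j.succ).det| = |e 0 0| := by
  set Q : Matrix (Fin (n + 1)) (Fin (n + 1)) ℝ := Matrix.of fun i k => e k i with hQ
  have h1 : Q.transpose * Q = 1 := by
    ext i j
    have := orthonormal_iff_ite.1 e.orthonormal i j
    rw [PiLp.inner_apply] at this
    rw [Matrix.mul_apply, Matrix.one_apply, ← this]
    refine Finset.sum_congr rfl fun k _ => ?_
    simp [hQ, mul_comm]
  have h2 : Q * Q.transpose = 1 := mul_eq_one_comm.1 h1
  have h3 : Q.adjugate = Q.det • Q.transpose := by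
    calc Q.adjugate = Q.adjugate * (Q * Q.transpose) := by rw [h2, mul_one]
      _ = Q.det • Q.transpose := by
        rw [← mul_assoc, Matrix.adjugate_mul, Matrix.smul_mul, one_mul]
  have h4 : Q.det * Q.det = 1 := by
    have := congrArg Matrix.det h1
    rwa [Matrix.det_mul, Matrix.det_transpose, Matrix.det_one] at this
  have h5 : |Q.det| = 1 := by
    have : |Q.det| * |Q.det| = 1 := by rw [← abs_mul, h4, abs_one]
    nlinarith [abs_nonneg Q.det]
  have h6 := congrFun (congrFun h3 0) 0
  rw [Matrix.adjugate_fin_succ_eq_det_submatrix] at h6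
  simp only [Fin.val_zero, add_zero, pow_zero, one_mul, Matrix.smul_apply,
    Matrix.transpose_apply, smul_eq_mul, Fin.succAbove_zero] at h6
  have h7 : (Matrix.of fun j k : Fin n => e k.succ j.succ) = Q.submatrix Fin.succ Fin.succ := by
    ext j k
    simp [hQ]
  rw [h7, h6, abs_mul, h5, one_mul]
  simp [hQ]

/-- The volume of a hyperplane section of the cube, computed by projecting it along the first
coordinate axis. -/
theorem euclideanHausdorffMeasure_section {n : ℕ} (a : EuclideanSpace ℝ (Fin (n + 1)))
    (ha : ‖a‖ = 1) (ha0 : 0 < a 0) (b : ℝ) :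
    μHE[n] ({x : EuclideanSpace ℝ (Fin (n + 1)) | ∑ i, a i * x i = b} ∩ cube (n + 1)) =
      ENNReal.ofReal (a 0)⁻¹ * volume {y : Fin n → ℝ | (∀ i, y i ∈ Set.Icc (0 : ℝ) 1) ∧
        (b - ∑ i : Fin n, a i.succ * y i) / a 0 ∈ Set.Icc (0 : ℝ) 1} := by
  obtain ⟨e, he⟩ : ∃ e : OrthonormalBasis (Fin (n + 1)) ℝ (EuclideanSpace ℝ (Fin (n + 1))),
      e 0 = a := by
    have hv : Orthonormal ℝ (({0} : Set (Fin (n + 1))).domRestrict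
        (fun _ => a : Fin (n + 1) → EuclideanSpace ℝ (Fin (n + 1)))) := by
      refine ⟨fun i => ha, fun i j hij => ?_⟩
      exact absurd (Subsingleton.elim i j) hij
    obtain ⟨e, he⟩ := hv.exists_orthonormalBasis_extension_of_card_eq (by simp)
    exact ⟨e, he 0 rfl⟩
  let f : EuclideanSpace ℝ (Fin n) → EuclideanSpace ℝ (Fin (n + 1)) := fun y =>
    e.repr.symm (WithLp.toLp 2 (Fin.cons b y.ofLp))
  have hf : Isometry f := by
    refine e.repr.symm.isometry.comp (Isometry.of_dist_eq fun y y' => ?_)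
    rw [EuclideanSpace.dist_eq, EuclideanSpace.dist_eq, Fin.sum_univ_succ]
    simp
  have hinner : ∀ x : EuclideanSpace ℝ (Fin (n + 1)), ∑ i, a i * x i = e.repr x 0 := by
    intro x
    rw [e.repr_apply_apply, he, PiLp.inner_apply]
    simp [mul_comm]
  have hfH : ∀ y, ∑ i, a i * f y i = b := by
    intro y
    rw [hinner]
    simp [f]
  have himage : {x : EuclideanSpace ℝ (Fin (n + 1)) | ∑ i, a i * x i = b} ∩ cube (n + 1) =
      f '' (f ⁻¹' cube (n + 1)) := by
    rw [Set.image_preimage_eq_range_inter]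
    congr 1
    ext x
    constructor
    · intro hx
      refine ⟨WithLp.toLp 2 fun i => e.repr x i.succ, ?_⟩
      rw [LinearIsometryEquiv.symm_apply_eq]
      ext i
      refine Fin.cases ?_ (fun j => ?_) i
      · rw [← hinner]
        exact hx.symm
      · rfl
    · rintro ⟨y, rfl⟩
      exact hfH y
  set M : Matrix (Fin n) (Fin n) ℝ := Matrix.of fun j k : Fin n => e k.succ j.succ with hM
  have hdet : |M.det| = a 0 := by
    rw [abs_det_minor_of_orthonormalBasis, he, abs_of_pos ha0]
  set S := {y : Fin n → ℝ | (∀ i, y i ∈ Set.Icc (0 : ℝ) 1) ∧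
        (b - ∑ i : Fin n, a i.succ * y i) / a 0 ∈ Set.Icc (0 : ℝ) 1} with hS
  let c : Fin n → ℝ := fun j => b * a j.succ
  have hcoord : ∀ y : EuclideanSpace ℝ (Fin n), ∀ j : Fin n,
      f y j.succ = (Matrix.toLin' M y.ofLp + c) j := by
    intro y j
    have h1 : f y = ∑ k, (Fin.cons b y.ofLp : Fin (n + 1) → ℝ) k • e k :=
      (e.sum_repr_symm _).symm
    rw [h1, Fin.sum_univ_succ]
    simp [he, c, hM, Matrix.mulVec, dotProduct, mul_comm, add_comm]
  have hpre : f ⁻¹' cube (n + 1) =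
      (WithLp.ofLp : EuclideanSpace ℝ (Fin n) → (Fin n → ℝ)) ⁻¹'
        (Matrix.toLin' M ⁻¹' ((fun y => y + c) ⁻¹' S)) := by
    ext y
    simp only [Set.mem_preimage, cube, Set.mem_ofPred_eq, Fin.forall_fin_succ, hS, ← hcoord]
    have h0 : f y 0 = (b - ∑ i : Fin n, a i.succ * f y i.succ) / a 0 := by
      rw [eq_div_iff ha0.ne', ← hfH y, Fin.sum_univ_succ]
      ring
    rw [h0, and_comm]
  have hdet' : LinearMap.det (Matrix.toLin' M) = M.det := LinearMap.det_toLin' M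
  have hne : M.det ≠ 0 := fun h => by
    rw [h, abs_zero] at hdet
    exact ha0.ne hdet
  rw [himage, hf.euclideanHausdorffMeasure_image,
    EuclideanSpace.euclideanHausdorffMeasure_eq_volume, hpre]
  have hvp := (EuclideanSpace.volume_preserving_symm_measurableEquiv_toLp (Fin n))
  have h2 : (WithLp.ofLp : EuclideanSpace ℝ (Fin n) → (Fin n → ℝ)) =
    (MeasurableEquiv.toLp 2 (Fin n → ℝ)).symm := rfl
  rw [h2, hvp.measure_preimage_equiv, Measure.addHaar_preimage_linearMap volume (by rwa [hdet']),
    measure_preimage_add_right, hdet', abs_inv, hdet]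

theorem sectionVolume_eq {n : ℕ} (hn : n ≠ 0) (a : EuclideanSpace ℝ (Fin (n + 1)))
    (ha : ‖a‖ = 1) (hpos : ∀ i, 0 < a i) (t : ℝ) :
    sectionVolume (n + 1) t a ≠ ⊤ ∧ (sectionVolume (n + 1) t a).toReal =
      altSum (posPow n) a.ofLp ((∑ i, a i) / 2 - t) / (n.factorial * ∏ i, a i) := by
  obtain ⟨h1, h2⟩ := volume_slab hn a.ofLp hpos ((∑ i, a i) / 2 - t)
  have h3 : sectionVolume (n + 1) t a = _ :=
    euclideanHausdorffMeasure_section a ha (hpos 0) ((∑ i, a i) / 2 - t)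
  rw [h3]
  refine ⟨ENNReal.mul_ne_top ENNReal.ofReal_ne_top h1, ?_⟩
  rw [ENNReal.toReal_mul, ENNReal.toReal_ofReal (inv_nonneg.2 (hpos 0).le), h2,
    Fin.prod_univ_succ, inv_mul_eq_div, div_div]
  congr 1
  ring

/-- Reflecting the cube in its coordinate midplanes makes all coordinates of the normal vector
nonnegative. -/
theorem sectionVolume_abs (d : ℕ) (t : ℝ) (a : EuclideanSpace ℝ (Fin d)) :
    sectionVolume d t (WithLp.toLp 2 fun i => |a i|) = sectionVolume d t a := by
  classical
  let r : EuclideanSpace ℝ (Fin d) → EuclideanSpace ℝ (Fin d) := fun x =>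
    WithLp.toLp 2 fun i => if a i < 0 then 1 - x i else x i
  have hr : Isometry r := by
    refine Isometry.of_dist_eq fun x y => ?_
    rw [EuclideanSpace.dist_eq, EuclideanSpace.dist_eq]
    congr 1
    refine Finset.sum_congr rfl fun i _ => ?_
    simp only [r]
    split_ifs
    · rw [Real.dist_eq, Real.dist_eq, sub_sub_sub_cancel_left, abs_sub_comm]
    · rfl
  have hrr : ∀ x, r (r x) = x := by
    intro x
    ext i
    simp only [r]
    split_ifs <;> simp
  have hsum : ∀ x, ∑ i, |a i| * r x i - (∑ i, |a i|) / 2 = ∑ i, a i * x i - (∑ i, a i) / 2 := by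
    intro x
    rw [Finset.sum_div, Finset.sum_div, ← Finset.sum_sub_distrib, ← Finset.sum_sub_distrib]
    refine Finset.sum_congr rfl fun i _ => ?_
    simp only [r]
    split_ifs with h
    · rw [abs_of_neg h]; ring
    · rw [abs_of_nonneg (not_lt.1 h)]
  have hcube : ∀ x, r x ∈ cube d ↔ x ∈ cube d := by
    intro x
    simp only [cube, Set.mem_ofPred_eq, Set.mem_Icc]
    refine forall_congr' fun i => ?_
    simp only [r]
    split_ifs
    · constructor <;> rintro ⟨h1, h2⟩ <;> constructor <;> linarith
    · rfl
  have hmem : ∀ x, r x ∈ hyperplane d t (WithLp.toLp 2 fun i => |a i|) ↔ x ∈ hyperplane d t a := by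
    intro x
    simp only [hyperplane, Set.mem_ofPred_eq]
    constructor <;> intro h <;> linarith [hsum x]
  have himage : hyperplane d t (WithLp.toLp 2 fun i => |a i|) ∩ cube d =
      r '' (hyperplane d t a ∩ cube d) := by
    ext x
    constructor
    · rintro ⟨h1, h2⟩
      refine ⟨r x, ⟨(hmem _).1 ?_, (hcube _).1 ?_⟩, hrr x⟩ <;> rwa [hrr]
    · rintro ⟨y, ⟨h1, h2⟩, rfl⟩
      exact ⟨(hmem y).2 h1, (hcube y).2 h2⟩
  unfold sectionVolume
  rw [himage, hr.euclideanHausdorffMeasure_image]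

open Filter Asymptotics

theorem posPow_succ (n : ℕ) (x : ℝ) : posPow (n + 1) x = x * posPow n x := by
  unfold posPow
  split_ifs <;> ring

theorem hasDerivAt_posPow (n : ℕ) (x : ℝ) :
    HasDerivAt (posPow (n + 2)) ((n + 2) * posPow (n + 1) x) x := by
  rcases eq_or_ne x 0 with rfl | hx
  · rw [posPow_of_nonpos (Nat.succ_ne_zero n) le_rfl, mul_zero, hasDerivAt_iff_isLittleO_nhds_zero]
    have h1 : Tendsto (posPow (n + 1)) (𝓝 0) (𝓝 0) := by
      have := (continuous_posPow (Nat.succ_ne_zero n)).tendsto 0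
      rwa [posPow_of_nonpos (Nat.succ_ne_zero n) le_rfl] at this
    have h2 := (isBigO_refl (fun δ : ℝ => δ) (𝓝 0)).mul_isLittleO
      ((isLittleO_one_iff ℝ).2 h1)
    refine h2.congr (fun δ => ?_) (fun δ => mul_one δ)
    rw [zero_add, posPow_succ (n + 1) δ, posPow_of_nonpos (Nat.succ_ne_zero _) le_rfl]
    simp
  · have := hasDerivAt_posPow_succ (n + 1) hx
    push_cast at this
    convert this using 2
    ring

/-- Second-order Taylor expansion with Peano remainder. -/
theorem isLittleO_taylor_two {f f' : ℝ → ℝ} {f'' y : ℝ} (hf : ∀ x, HasDerivAt f (f' x) x)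
    (hf' : HasDerivAt f' f'' y) :
    (fun δ => f (y + δ) - (f y + f' y * δ + f'' / 2 * δ ^ 2)) =o[𝓝 0] fun δ => δ ^ 2 := by
  rw [isLittleO_iff]
  intro c hc
  have h1 := (isLittleO_iff.1 (hasDerivAt_iff_isLittleO_nhds_zero.1 hf')) hc
  obtain ⟨ε, hε, h2⟩ := Metric.eventually_nhds_iff_ball.1 h1
  filter_upwards [Metric.ball_mem_nhds (0 : ℝ) hε] with δ hδ
  have hder : ∀ s ∈ Metric.closedBall (0 : ℝ) |δ|, HasDerivWithinAt
      (fun s => f (y + s) - (f y + f' y * s + f'' / 2 * s ^ 2))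
      (f' (y + s) - f' y - s * f'') (Metric.closedBall (0 : ℝ) |δ|) s := by
    intro s _
    have e1 : HasDerivAt (fun s => f (y + s)) (f' (y + s)) s := by
      simpa using (hf (y + s)).comp_const_add y s
    have e2 : HasDerivAt (fun s : ℝ => f y + f' y * s + f'' / 2 * s ^ 2)
        (f' y + f'' * s) s := by
      have := (((hasDerivAt_id s).const_mul (f' y)).const_add (f y)).add
        ((hasDerivAt_pow 2 s).const_mul (f'' / 2))
      refine this.congr_deriv ?_
      simp; ring
    exact ((e1.sub e2).congr_deriv (by ring)).hasDerivWithinAt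
  have hbound : ∀ s ∈ Metric.closedBall (0 : ℝ) |δ|, ‖f' (y + s) - f' y - s * f''‖ ≤ c * |δ| := by
    intro s hs
    have hs' : |s| ≤ |δ| := by simpa using hs
    have h3 := h2 s (by
      simp only [Metric.mem_ball, dist_zero_right, Real.norm_eq_abs] at hδ ⊢
      exact hs'.trans_lt hδ)
    refine h3.trans ?_
    rw [Real.norm_eq_abs]
    gcongr
  have := (convex_closedBall (0 : ℝ) |δ|).norm_image_sub_le_of_norm_hasDerivWithin_le hder hbound
    (x := 0) (y := δ) (by simp) (by simp)
  simp only [add_zero, mul_zero, sub_zero, ne_eq, OfNat.ofNat_ne_zero, not_false_eq_true, zero_pow,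
    sub_self] at this
  refine this.trans (le_of_eq ?_)
  rw [Real.norm_eq_abs, norm_pow, Real.norm_eq_abs]
  ring

theorem isLittleO_comp_expansion {α : Type*} {l : Filter α} {f f' : ℝ → ℝ} {f'' y β : ℝ}
    (hf : ∀ x, HasDerivAt f (f' x) x) (hf' : HasDerivAt f' f'' y) {q w s : α → ℝ}
    (hq : Tendsto q l (𝓝 0)) (hw : (fun x => w x + β * q x) =o[l] q)
    (hs : Tendsto s l (𝓝 0)) (hsq : (fun x => s x ^ 2) =O[l] q) :
    (fun x => f (y + (w x - s x)) - (f y - f' y * (β * q x + s x) + f'' / 2 * s x ^ 2))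
      =o[l] q := by
  have hwO : w =O[l] q := by
    have := hw.isBigO.sub ((isBigO_refl q l).const_mul_left β)
    simpa using this
  have hw0 : Tendsto w l (𝓝 0) := hwO.trans_tendsto hq
  have hδ : Tendsto (fun x => w x - s x) l (𝓝 0) := by simpa using hw0.sub hs
  have h1 : (fun x => (w x - s x) ^ 2 - s x ^ 2) =o[l] q := by
    have h2 : Tendsto (fun x => w x - 2 * s x) l (𝓝 0) := by simpa using hw0.sub (hs.const_mul 2)
    have h3 := hwO.mul_isLittleO ((isLittleO_one_iff ℝ).2 h2)
    refine h3.congr (fun x => ?_) (fun x => mul_one _)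
    ring
  have h2 : (fun x => (w x - s x) ^ 2) =O[l] q := by
    simpa using h1.isBigO.add hsq
  have h3 := ((isLittleO_taylor_two hf hf').comp_tendsto hδ).trans_isBigO h2
  have h4 := (h3.add (hw.const_mul_left (f' y))).add (h1.const_mul_left (f'' / 2))
  refine h4.congr_left fun x => ?_
  simp only [Function.comp_apply]
  ring

theorem isLittleO_mul_expansion {α : Type*} {l : Filter α} {f g q : α → ℝ} {a a' b b' : ℝ}
    (hq : Tendsto q l (𝓝 0)) (hf : (fun x => f x - (a + a' * q x)) =o[l] q)
    (hg : (fun x => g x - (b + b' * q x)) =o[l] q) :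
    (fun x => f x * g x - (a * b + (a * b' + a' * b) * q x)) =o[l] q := by
  have hqq : (fun x => q x * q x) =o[l] q := by
    simpa using (isBigO_refl q l).mul_isLittleO ((isLittleO_one_iff ℝ).2 hq)
  have hg0 : Tendsto g l (𝓝 b) := by
    have h1 := (hg.isBigO.trans_tendsto hq).add ((hq.const_mul b').const_add b)
    simpa using h1
  have h1 : (fun x => (f x - (a + a' * q x)) * g x) =o[l] q := by
    simpa using hf.mul_isBigO (hg0.isBigO_one ℝ)
  have hb : Tendsto (fun x => a + a' * q x) l (𝓝 a) := by simpa using (hq.const_mul a').const_add a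
  have h2 : (fun x => (a + a' * q x) * (g x - (b + b' * q x))) =o[l] q := by
    simpa using (hb.isBigO_one ℝ).mul_isLittleO hg
  refine ((h1.add h2).add (hqq.const_mul_left (a' * b'))).congr_left fun x => ?_
  ring

theorem sq_sum_isBigO {α : Type*} {l : Filter α} {d : ℕ} (h : α → Fin d → ℝ)
    (T : Finset (Fin d)) :
    (fun x => (∑ i ∈ T, h x i) ^ 2) =O[l] fun x => ∑ i, h x i ^ 2 := by
  refine IsBigO.of_bound (T.card : ℝ) (Eventually.of_forall fun x => ?_)
  rw [Real.norm_of_nonneg (sq_nonneg _), Real.norm_of_nonneg (Finset.sum_nonneg fun _ _ =>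
    sq_nonneg _)]
  refine (sq_sum_le_card_mul_sum_sq).trans ?_
  gcongr
  exact Finset.subset_univ T

theorem tendsto_sum_sq {α : Type*} {l : Filter α} {d : ℕ} {h : α → Fin d → ℝ}
    (h0 : ∀ i, Tendsto (fun x => h x i) l (𝓝 0)) :
    Tendsto (fun x => ∑ i, h x i ^ 2) l (𝓝 0) := by
  simpa using tendsto_finsetSum Finset.univ fun i _ => (h0 i).pow 2

theorem isLittleO_prod_one_add {α : Type*} {l : Filter α} {d : ℕ} {h : α → Fin d → ℝ}
    (h0 : ∀ i, Tendsto (fun x => h x i) l (𝓝 0)) (S : Finset (Fin d)) :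
    (fun x => ∏ i ∈ S, (1 + h x i) -
      (1 + ∑ i ∈ S, h x i + ((∑ i ∈ S, h x i) ^ 2 - ∑ i ∈ S, h x i ^ 2) / 2))
      =o[l] fun x => ∑ i, h x i ^ 2 := by
  classical
  induction S using Finset.induction_on with
  | empty => simp
  | insert j S hj ih =>
    have hq : (fun x => ∑ i ∈ S, h x i ^ 2) =O[l] fun x => ∑ i, h x i ^ 2 := by
      refine IsBigO.of_bound 1 (Eventually.of_forall fun x => ?_)
      rw [one_mul, Real.norm_of_nonneg (Finset.sum_nonneg fun _ _ => sq_nonneg _),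
        Real.norm_of_nonneg (Finset.sum_nonneg fun _ _ => sq_nonneg _)]
      exact Finset.sum_le_sum_of_subset_of_nonneg (Finset.subset_univ S) fun _ _ _ => sq_nonneg _
    have h1 := (ih.mul_isBigO (((h0 j).const_add 1).isBigO_one ℝ))
    have h2 := ((isLittleO_one_iff ℝ).2 (h0 j)).mul_isBigO
      (((sq_sum_isBigO (l := l) h S).sub hq).const_mul_left (1 / 2))
    simp only [mul_one, one_mul] at h1 h2
    refine (h1.add h2).congr_left fun x => ?_
    rw [Finset.prod_insert hj, Finset.sum_insert hj, Finset.sum_insert hj]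
    ring

theorem isLittleO_sqrt_add {α : Type*} {l : Filter α} {q : α → ℝ} (hq : Tendsto q l (𝓝 0)) {c : ℝ}
    (hc : 0 < c) : (fun x => √(c + q x) - (√c + 1 / (2 * √c) * q x)) =o[l] q := by
  have h1 := (hasDerivAt_iff_isLittleO_nhds_zero.1 (Real.hasDerivAt_sqrt hc.ne')).comp_tendsto hq
  refine h1.congr_left fun x => ?_
  simp only [Function.comp_apply, smul_eq_mul]
  ring

theorem sum_finset_apply_card {d : ℕ} (φ : ℕ → ℝ) :
    ∑ T : Finset (Fin d), φ T.card = ∑ k ∈ Finset.range (d + 1), d.choose k * φ k := by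
  rw [← Finset.powerset_univ, Finset.sum_powerset_apply_card]
  simp

theorem sum_finset_mem {d : ℕ} (φ : ℕ → ℝ) (i : Fin d) :
    ∑ T : Finset (Fin d), (if i ∈ T then φ T.card else 0) =
      ∑ k ∈ Finset.range d, (d - 1).choose k * φ (k + 1) := by
  have hi : i ∉ Finset.univ.erase i := Finset.notMem_erase i _
  have hd : d - 1 + 1 = d := Nat.sub_add_cancel (Fin.pos i)
  rw [← Finset.powerset_univ, ← Finset.insert_erase (Finset.mem_univ i),
    Finset.sum_powerset_insert hi, Finset.sum_eq_zero, zero_add]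
  · trans ∑ T ∈ (Finset.univ.erase i).powerset, φ (T.card + 1)
    · refine Finset.sum_congr rfl fun T hT => ?_
      have hiT : i ∉ T := fun h => hi (Finset.mem_powerset.1 hT h)
      rw [if_pos (Finset.mem_insert_self _ _), Finset.card_insert_of_notMem hiT]
    · rw [Finset.sum_powerset_apply_card fun k => φ (k + 1)]
      simp [hd]
  · intro T hT
    exact if_neg fun h => hi (Finset.mem_powerset.1 hT h)

theorem sum_finset_mem_notMem {d : ℕ} (φ : ℕ → ℝ) {i j : Fin d} (hij : i ≠ j) :
    ∑ T : Finset (Fin d), (if i ∈ T ∧ j ∉ T then φ T.card else 0) =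
      ∑ k ∈ Finset.range (d - 1), (d - 2).choose k * φ (k + 1) := by
  set R := (Finset.univ.erase j).erase i with hR
  have hjR : j ∉ insert i R := by simp [hR, hij.symm]
  have hiR : i ∉ R := by simp [hR]
  have huniv : (Finset.univ : Finset (Fin d)) = insert j (insert i R) := by
    rw [hR, Finset.insert_erase (by simp [hij]), Finset.insert_erase (Finset.mem_univ j)]
  have hcard : d = R.card + 1 + 1 := by
    conv_lhs => rw [← Fintype.card_fin d, ← Finset.card_univ, huniv,
      Finset.card_insert_of_notMem hjR, Finset.card_insert_of_notMem hiR]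
  have hd2 : d - 2 = R.card := by omega
  have hd1 : d - 1 = R.card + 1 := by omega
  rw [← Finset.powerset_univ, huniv, Finset.sum_powerset_insert hjR,
    Finset.sum_eq_zero (s := (insert i R).powerset) (f := fun T => if i ∈ insert j T ∧ j ∉ insert j T
      then φ (insert j T).card else 0) (fun T _ => if_neg (by simp)), add_zero,
    Finset.sum_powerset_insert hiR, Finset.sum_eq_zero, zero_add]
  · trans ∑ T ∈ R.powerset, φ (T.card + 1)
    · refine Finset.sum_congr rfl fun T hT => ?_
      have hTR := Finset.mem_powerset.1 hT
      have hiT : i ∉ T := fun h => hiR (hTR h)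
      have hjT : j ∉ insert i T := fun h => hjR (Finset.insert_subset_insert i hTR h)
      rw [if_pos ⟨Finset.mem_insert_self _ _, hjT⟩, Finset.card_insert_of_notMem hiT]
    · rw [Finset.sum_powerset_apply_card fun k => φ (k + 1), hd1, hd2]
      simp
  · intro T hT
    exact if_neg fun h => hiR (Finset.mem_powerset.1 hT h.1)

theorem sum_finset_linear {d : ℕ} (φ : ℕ → ℝ) {h : Fin d → ℝ} (hh : ∑ i, h i = 0) :
    ∑ T : Finset (Fin d), φ T.card * ∑ i ∈ T, h i = 0 := by
  have h1 : ∀ T : Finset (Fin d), φ T.card * ∑ i ∈ T, h i =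
      ∑ i, h i * (if i ∈ T then φ T.card else 0) := by
    intro T
    simp only [mul_ite, mul_zero]
    rw [Finset.mul_sum, ← Finset.sum_filter]
    simp [mul_comm]
  simp only [h1]
  rw [Finset.sum_comm]
  simp only [← Finset.mul_sum, sum_finset_mem]
  rw [← Finset.sum_mul, hh, zero_mul]

theorem sum_finset_quadratic {d : ℕ} (φ : ℕ → ℝ) {h : Fin d → ℝ} (hh : ∑ i, h i = 0) :
    ∑ T : Finset (Fin d), φ T.card * (∑ i ∈ T, h i) ^ 2 =
      (∑ k ∈ Finset.range (d - 1), (d - 2).choose k * φ (k + 1)) * ∑ i, h i ^ 2 := by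
  set R := ∑ k ∈ Finset.range (d - 1), (d - 2).choose k * φ (k + 1) with hR
  have h1 : ∀ T : Finset (Fin d), φ T.card * (∑ i ∈ T, h i) ^ 2 =
      ∑ i, ∑ j, -(h i * h j) * (if i ∈ T ∧ j ∉ T then φ T.card else 0) := by
    intro T
    have h2 : ∑ j, (if j ∉ T then h j else 0) = -∑ i ∈ T, h i := by
      rw [← Finset.sum_filter, eq_neg_iff_add_eq_zero, add_comm, ← hh,
        ← Finset.sum_filter_add_sum_filter_not Finset.univ (· ∈ T)]
      simp
    have h3 : ∑ i, (if i ∈ T then h i else 0) = ∑ i ∈ T, h i := by simp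
    rw [sq]
    nth_rewrite 2 [← neg_neg (∑ i ∈ T, h i)]
    rw [← h2, ← h3, mul_neg, Finset.sum_mul_sum, mul_neg, Finset.mul_sum, ← Finset.sum_neg_distrib]
    refine Finset.sum_congr rfl fun i _ => ?_
    rw [Finset.mul_sum, ← Finset.sum_neg_distrib]
    refine Finset.sum_congr rfl fun j _ => ?_
    by_cases hi : i ∈ T <;> by_cases hj : j ∈ T <;> simp [hi, hj]
    ring
  simp only [h1]
  rw [Finset.sum_comm, Finset.mul_sum]
  refine Finset.sum_congr rfl fun i _ => ?_
  rw [Finset.sum_comm]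
  have h4 : ∀ j, ∑ T : Finset (Fin d), -(h i * h j) * (if i ∈ T ∧ j ∉ T then φ T.card else 0) =
      -(h i * h j) * R + if j = i then h i * h i * R else 0 := by
    intro j
    rw [← Finset.mul_sum]
    split_ifs with hji
    · subst hji
      simp
    · rw [sum_finset_mem_notMem φ (Ne.symm hji), add_zero]
  simp only [h4]
  rw [Finset.sum_add_distrib, Finset.sum_ite_eq' Finset.univ i, ← Finset.sum_mul,
    Finset.sum_neg_distrib, ← Finset.mul_sum, hh]
  simp
  ring

theorem isLittleO_altSum {α : Type*} {l : Filter α} {d : ℕ} {f f' f'' : ℝ → ℝ} {z β : ℝ}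
    (hf : ∀ x, HasDerivAt f (f' x) x) (hf' : ∀ x, HasDerivAt f' (f'' x) x)
    {h : α → Fin d → ℝ} {w : α → ℝ} (h0 : ∀ i, Tendsto (fun x => h x i) l (𝓝 0))
    (hh : ∀ x, ∑ i, h x i = 0)
    (hw : (fun x => w x + β * ∑ i, h x i ^ 2) =o[l] fun x => ∑ i, h x i ^ 2) :
    (fun x => altSum f (fun i => 1 + h x i) (z + w x) -
      (∑ k ∈ Finset.range (d + 1), d.choose k * ((-1) ^ k * f (z - k)) +
        (-β * ∑ k ∈ Finset.range (d + 1), d.choose k * ((-1) ^ k * f' (z - k)) +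
          1 / 2 * ∑ k ∈ Finset.range (d - 1),
            (d - 2).choose k * ((-1) ^ (k + 1) * f'' (z - (k + 1)))) * ∑ i, h x i ^ 2))
      =o[l] fun x => ∑ i, h x i ^ 2 := by
  have hq := tendsto_sum_sq h0
  have h1 : ∀ T : Finset (Fin d), (fun x => (-1) ^ T.card *
      (f (z - T.card + (w x - ∑ i ∈ T, h x i)) - (f (z - T.card) -
        f' (z - T.card) * (β * ∑ i, h x i ^ 2 + ∑ i ∈ T, h x i) +
        f'' (z - T.card) / 2 * (∑ i ∈ T, h x i) ^ 2))) =o[l] fun x => ∑ i, h x i ^ 2 := by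
    intro T
    refine (isLittleO_comp_expansion hf (hf' _) hq hw ?_ (sq_sum_isBigO h T)).const_mul_left _
    simpa using tendsto_finsetSum T fun i _ => h0 i
  refine (IsLittleO.sum (s := Finset.univ) fun T _ => h1 T).congr_left fun x => ?_
  have e0 := sum_finset_apply_card (d := d) fun k => (-1) ^ k * f (z - k)
  have e1 := sum_finset_apply_card (d := d) fun k => (-1) ^ k * f' (z - k)
  have e2 := sum_finset_linear (fun k => (-1) ^ k * f' (z - k)) (hh x)
  have e3 := sum_finset_quadratic (fun k => (-1) ^ k * f'' (z - k)) (hh x)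
  simp only [Nat.cast_add, Nat.cast_one] at e3
  have e4 : altSum f (fun i => 1 + h x i) (z + w x) = ∑ T : Finset (Fin d),
      (-1) ^ T.card * f (z - T.card + (w x - ∑ i ∈ T, h x i)) := by
    refine Finset.sum_congr rfl fun T _ => ?_
    congr 2
    rw [Finset.sum_add_distrib]
    simp
    ring
  rw [e4, ← e0, ← e1, add_mul, mul_assoc (1 / 2 : ℝ), ← e3]
  have e5 : ∀ T : Finset (Fin d), (-1) ^ T.card *
      (f (z - T.card + (w x - ∑ i ∈ T, h x i)) - (f (z - T.card) -
        f' (z - T.card) * (β * ∑ i, h x i ^ 2 + ∑ i ∈ T, h x i) +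
        f'' (z - T.card) / 2 * (∑ i ∈ T, h x i) ^ 2)) =
      (-1) ^ T.card * f (z - T.card + (w x - ∑ i ∈ T, h x i)) - (-1) ^ T.card * f (z - T.card) +
      (β * ∑ i, h x i ^ 2) * ((-1) ^ T.card * f' (z - T.card)) +
      (-1) ^ T.card * f' (z - T.card) * ∑ i ∈ T, h x i -
      1 / 2 * ((-1) ^ T.card * f'' (z - T.card) * (∑ i ∈ T, h x i) ^ 2) := fun T => by ring
  rw [Finset.sum_apply]
  simp only [e5]
  rw [Finset.sum_sub_distrib, Finset.sum_add_distrib, Finset.sum_add_distrib,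
    Finset.sum_sub_distrib, e2, ← Finset.mul_sum, ← Finset.mul_sum]
  ring

/-- Up to a positive factor, the second derivative of the section volume at a diagonal of the
`(m + 4)`-dimensional cube, as a function of `z = d / 2 - t * √d`. -/
noncomputable def curvature (m : ℕ) (z : ℝ) : ℝ :=
  2 * (m + 5) *
      ∑ k ∈ Finset.range (m + 5), (m + 4).choose k * ((-1) ^ k * posPow (m + 3) (z - k)) -
    (m + 4 - 2 * z) * ∑ k ∈ Finset.range (m + 5),
      (m + 4).choose k * ((-1) ^ k * ((m + 3) * posPow (m + 2) (z - k))) +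
    2 * (m + 4) * ∑ k ∈ Finset.range (m + 3),
      (m + 2).choose k * ((-1) ^ (k + 1) * ((m + 3) * ((m + 2) * posPow (m + 1) (z - (k + 1)))))

theorem isLittleO_section {α : Type*} {l : Filter α} {m : ℕ} {h : α → Fin (m + 4) → ℝ}
    (h0 : ∀ i, Tendsto (fun x => h x i) l (𝓝 0)) (hh : ∀ x, ∑ i, h x i = 0) (t : ℝ) :
    (fun x => √(m + 4 + ∑ i, h x i ^ 2) *
        altSum (posPow (m + 3)) (fun i => 1 + h x i)
          ((m + 4) / 2 - t * √(m + 4 + ∑ i, h x i ^ 2)) -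
      √(m + 4) * altSum (posPow (m + 3)) (fun _ : Fin (m + 4) => 1)
          ((m + 4) / 2 - t * √(m + 4)) * ∏ i, (1 + h x i) -
      √(m + 4) / (4 * (m + 4)) * curvature m ((m + 4) / 2 - t * √(m + 4)) * ∑ i, h x i ^ 2)
      =o[l] fun x => ∑ i, h x i ^ 2 := by
  have hq := tendsto_sum_sq h0
  have hd : (0 : ℝ) < m + 4 := by positivity
  set r : ℝ := √(m + 4) with hr
  have hr0 : 0 < r := Real.sqrt_pos.2 hd
  have hr2 : r * r = m + 4 := Real.mul_self_sqrt hd.le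
  set z : ℝ := (m + 4) / 2 - t * r with hz
  have h1 := isLittleO_sqrt_add hq hd
  rw [← hr] at h1
  have h2 := isLittleO_altSum (z := z) (β := t / (2 * r)) (f := posPow (m + 3))
    (f' := fun x => (m + 3) * posPow (m + 2) x)
    (f'' := fun x => (m + 3) * ((m + 2) * posPow (m + 1) x))
    (w := fun x => (m + 4) / 2 - t * √(m + 4 + ∑ i, h x i ^ 2) - z)
    (fun x => by
      refine (hasDerivAt_posPow (m + 1) x).congr_deriv ?_
      push_cast; ring)
    (fun x => (hasDerivAt_posPow m x).const_mul ((m : ℝ) + 3)) h0 hh (by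
      refine (h1.const_mul_left (-t)).congr_left fun x => ?_
      rw [hz]; ring)
  have h3 := isLittleO_mul_expansion hq h1 h2
  have h4 := isLittleO_prod_one_add h0 Finset.univ
  simp only [hh] at h4
  have hA : altSum (posPow (m + 3)) (fun _ : Fin (m + 4) => 1) z =
      ∑ k ∈ Finset.range (m + 4 + 1), (m + 4).choose k * ((-1) ^ k * posPow (m + 3) (z - k)) := by
    rw [← sum_finset_apply_card (d := m + 4) fun k => (-1) ^ k * posPow (m + 3) (z - k)]
    simp [altSum]
  refine (h3.sub (h4.const_mul_left (r * altSum (posPow (m + 3))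
    (fun _ : Fin (m + 4) => 1) z))).congr_left fun x => ?_
  rw [hA, add_sub_cancel]
  have ht : t = ((m + 4) / 2 - z) / r := by rw [hz]; field_simp; ring
  unfold curvature
  simp only [show m + 4 + 1 = m + 5 from rfl, show m + 4 - 1 = m + 3 from rfl,
    show m + 4 - 2 = m + 2 from rfl]
  set A := ∑ k ∈ Finset.range (m + 5), ((m + 4).choose k : ℝ) *
    ((-1) ^ k * posPow (m + 3) (z - k))
  set A1 := ∑ k ∈ Finset.range (m + 5), ((m + 4).choose k : ℝ) *
    ((-1) ^ k * ((m + 3) * posPow (m + 2) (z - k)))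
  set B := ∑ k ∈ Finset.range (m + 3), ((m + 2).choose k : ℝ) *
    ((-1) ^ (k + 1) * ((m + 3) * ((m + 2) * posPow (m + 1) (z - (k + 1)))))
  set q := ∑ i, h x i ^ 2
  have hβ : t / (2 * r) = (m + 4 - 2 * z) / (4 * (m + 4)) := by
    rw [ht, ← hr2]
    field_simp
    linarith
  have hr1 : 1 / (2 * r) = r / (2 * (m + 4)) := by
    rw [← hr2]
    field_simp
  rw [hβ, hr1]
  field_simp
  ring


theorem sum_range_posPow {K N n : ℕ} (hKN : K < N) {z : ℝ} (h0 : K ≤ z) (h1 : z < K + 1)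
    (F : ℕ → ℝ → ℝ) (hF : ∀ k, F k 0 = 0) :
    ∑ k ∈ Finset.range N, F k (posPow n (z - k)) =
      ∑ k ∈ Finset.range (K + 1), F k ((z - k) ^ n) := by
  rw [← Finset.sum_subset (Finset.range_subset_range.2 (Nat.succ_le_of_lt hKN))]
  · refine Finset.sum_congr rfl fun k hk => ?_
    rw [posPow_of_nonneg]
    have : (k : ℝ) ≤ K := by exact_mod_cast Nat.lt_succ_iff.1 (Finset.mem_range.1 hk)
    linarith
  · intro k _ hk
    have h2 : K + 1 ≤ k := by simpa using hk
    have : (K : ℝ) + 1 ≤ k := by exact_mod_cast h2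
    rw [posPow_of_neg _ (by linarith), hF]

theorem sum_range_posPow_shift {K N n : ℕ} (hKN : K ≤ N) {z : ℝ} (h0 : K ≤ z) (h1 : z < K + 1)
    (F : ℕ → ℝ → ℝ) (hF : ∀ k, F k 0 = 0) :
    ∑ k ∈ Finset.range N, F k (posPow n (z - (k + 1))) =
      ∑ k ∈ Finset.range K, F k ((z - (k + 1)) ^ n) := by
  rw [← Finset.sum_subset (Finset.range_subset_range.2 hKN)]
  · refine Finset.sum_congr rfl fun k hk => ?_
    rw [posPow_of_nonneg]
    have : (k : ℝ) + 1 ≤ K := by exact_mod_cast Nat.succ_le_of_lt (Finset.mem_range.1 hk)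
    linarith
  · intro k _ hk
    have h2 : K ≤ k := by simpa using hk
    have : (K : ℝ) ≤ k := by exact_mod_cast h2
    rw [posPow_of_neg _ (by linarith), hF]

/-- On each unit interval, `curvature` is a polynomial. -/
theorem curvature_eq_of_mem_Ico {m K : ℕ} (hK : K < m + 4) {z : ℝ} (h0 : K ≤ z)
    (h1 : z < K + 1) :
    curvature m z = 2 * (m + 5) * ∑ k ∈ Finset.range (K + 1),
        (m + 4).choose k * ((-1) ^ k * (z - k) ^ (m + 3)) -
      (m + 4 - 2 * z) * ∑ k ∈ Finset.range (K + 1),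
        (m + 4).choose k * ((-1) ^ k * ((m + 3) * (z - k) ^ (m + 2))) +
      2 * (m + 4) * ∑ k ∈ Finset.range K,
        (m + 2).choose k * ((-1) ^ (k + 1) * ((m + 3) * ((m + 2) * (z - (k + 1)) ^ (m + 1)))) := by
  unfold curvature
  rw [sum_range_posPow (K := K) (by omega) h0 h1
      (fun k y => (m + 4).choose k * ((-1) ^ k * y)) (by simp),
    sum_range_posPow (K := K) (by omega) h0 h1
      (fun k y => (m + 4).choose k * ((-1) ^ k * ((m + 3) * y))) (by simp),
    sum_range_posPow_shift (K := K) (by omega) h0 h1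
      (fun k y => (m + 2).choose k * ((-1) ^ (k + 1) * ((m + 3) * ((m + 2) * y)))) (by simp)]

/-- A polynomial that decreases through zero changes sign exactly once. -/
theorem exists_sign_change (P : Polynomial ℝ) {l u : ℝ} (hlu : l ≤ u)
    (hP : ∀ w, l < w → w < u → P.derivative.eval w < 0) (hl : 0 < P.eval l) (hu : P.eval u < 0) :
    ∃ ρ, l < ρ ∧ ρ < u ∧ (∀ w, l ≤ w → w < ρ → 0 < P.eval w) ∧
      ∀ w, ρ < w → w ≤ u → P.eval w < 0 := by
  have hanti : StrictAntiOn (fun w => P.eval w) (Set.Icc l u) := by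
    refine strictAntiOn_of_deriv_neg (convex_Icc l u) P.continuous.continuousOn fun w hw => ?_
    rw [interior_Icc] at hw
    rw [P.deriv]
    exact hP w hw.1 hw.2
  obtain ⟨ρ, ⟨h1, h2⟩, h3⟩ := intermediate_value_Icc' hlu
    (P.continuous.continuousOn : ContinuousOn (fun w => P.eval w) _) ⟨hu.le, hl.le⟩
  simp only at h3
  have h1' : l ≠ ρ := by rintro rfl; exact hl.ne' h3
  have h2' : ρ ≠ u := by rintro rfl; exact hu.ne h3
  refine ⟨ρ, lt_of_le_of_ne h1 h1', lt_of_le_of_ne h2 h2', fun w hw hw' => ?_, fun w hw hw' => ?_⟩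
  · have := hanti ⟨hw, hw'.le.trans h2⟩ ⟨h1, h2⟩ hw'
    simpa only [h3] using this
  · have := hanti ⟨h1, h2⟩ ⟨h1.trans hw.le, hw'⟩ hw
    simpa only [h3] using this

/-- The function `f` is negative, positive and negative on the successive intervals of `(0, b)`
determined by some `p < q`. -/
def ChangesSignTwice (f : ℝ → ℝ) (b : ℝ) : Prop :=
  ∃ p q : ℝ, 0 < p ∧ p < q ∧ q < b ∧ (∀ z, 0 < z → z < p → f z < 0) ∧
    (∀ z, p < z → z < q → 0 < f z) ∧ ∀ z, q < z → z < b → f z < 0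

theorem curvature_first_piece (m : ℕ) {z : ℝ} (h0 : 0 ≤ z) (h1 : z < 1) :
    curvature m z = (m + 4) * z ^ (m + 2) * (4 * z - (m + 3)) := by
  rw [curvature_eq_of_mem_Ico (K := 0) (by omega) (by simpa) (by simpa)]
  simp
  ring

theorem curvature_first_piece_neg (m : ℕ) {z : ℝ} (h0 : 0 < z) (h1 : z < 1)
    (h2 : 4 * z < m + 3) : curvature m z < 0 := by
  rw [curvature_first_piece m h0.le h1]
  exact mul_neg_of_pos_of_neg (by positivity) (by linarith)

theorem changesSignTwice_curvature_zero : ChangesSignTwice (curvature 0) 2 := by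
  have e1 : ∀ z : ℝ, 1 ≤ z → z < 2 → curvature 0 z = 16 *
      (1 / 4 - 3 / 2 * (z - 1) + 15 / 4 * (z - 1) ^ 2 - 3 * (z - 1) ^ 3) := by
    intro z h1 h2
    rw [curvature_eq_of_mem_Ico (K := 1) (by norm_num) (by simpa) (by push_cast; linarith)]
    norm_num [Finset.sum_range_succ, Nat.choose]
    ring
  obtain ⟨ρ, hρ1, hρ2, hpos, hneg⟩ := exists_sign_change
    (.C (1 / 4) - .C (3 / 2) * .X + .C (15 / 4) * .X ^ 2 - .C 3 * .X ^ 3)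
    (l := 3 / 5) (u := 1) (by norm_num) (by
      intro w h1 h2
      have key : ∀ a b : ℝ, 0 < a → 0 < b →
          0 < 6 / 25 * b ^ 2 + 9 / 10 * 2 * a * b + 3 * a ^ 2 := by
        intros; positivity
      have := key (w - 3 / 5) (1 - w) (by linarith) (by linarith)
      simp
      nlinarith) (by norm_num) (by norm_num)
  simp only [Polynomial.eval_sub, Polynomial.eval_add, Polynomial.eval_mul, Polynomial.eval_C,
    Polynomial.eval_X, Polynomial.eval_pow] at hpos hneg
  refine ⟨3 / 4, 1 + ρ, by norm_num, by linarith, by linarith, fun z h0 h1 => ?_,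
    fun z h0 h1 => ?_, fun z h0 h1 => ?_⟩
  · exact curvature_first_piece_neg 0 h0 (by linarith) (by norm_num; linarith)
  · rcases lt_or_ge z 1 with hz | hz
    · rw [curvature_first_piece 0 (by linarith) hz]
      have : 0 < z := by linarith
      exact mul_pos (by positivity) (by norm_num; linarith)
    · rw [e1 z hz (by linarith)]
      refine mul_pos (by norm_num) ?_
      rcases lt_or_ge (z - 1) (3 / 5) with hw | hw
      · have key : ∀ a b : ℝ, 0 ≤ a → 0 < b → 0 < 1 / 4 * b ^ 4 + 1 / 40 * 4 * a * b ^ 3 +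
            1 / 40 * 6 * a ^ 2 * b ^ 2 + 11 / 125 * 4 * a ^ 3 * b + 13 / 250 * a ^ 4 := by
          intros; positivity
        have := key (z - 1) (3 / 5 - (z - 1)) (by linarith) (by linarith)
        nlinarith
      · exact hpos _ hw (by linarith)
  · rw [e1 z (by linarith) h1]
    exact mul_neg_of_pos_of_neg (by norm_num) (hneg _ (by linarith) (by linarith))

theorem changesSignTwice_curvature_one : ChangesSignTwice (curvature 1) (5 / 2) := by
  refine ⟨1, 2, by norm_num, by norm_num, by norm_num, fun z h0 h1 => ?_,
    fun z h0 h1 => ?_, fun z h0 h1 => ?_⟩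
  · exact curvature_first_piece_neg 1 h0 h1 (by norm_num; linarith)
  · have e1 : curvature 1 z = 20 * ((z - 1) * (2 - z) *
        ((1 - (z - 1)) ^ 2 + 3 * (z - 1) ^ 2)) := by
      rw [curvature_eq_of_mem_Ico (K := 1) (by norm_num) (by push_cast; linarith)
        (by push_cast; linarith)]
      norm_num [Finset.sum_range_succ, Nat.choose]
      ring
    have h2 : 0 < z - 1 := by linarith
    have h3 : 0 < 2 - z := by linarith
    rw [e1]
    positivity
  · have e1 : curvature 1 z = -(60 * ((z - 2) * (3 - z) *
        ((1 - (z - 2)) ^ 2 + (z - 2) ^ 2))) := by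
      rw [curvature_eq_of_mem_Ico (K := 2) (by norm_num) (by push_cast; linarith)
        (by push_cast; linarith)]
      norm_num [Finset.sum_range_succ, Nat.choose]
      ring
    have h2 : 0 < z - 2 := by linarith
    have h3 : 0 < 3 - z := by linarith
    rw [e1, neg_lt_zero]
    positivity

theorem changesSignTwice_curvature_two : ChangesSignTwice (curvature 2) 3 := by
  have e1 : ∀ z : ℝ, 1 ≤ z → z < 2 → curvature 2 z = -(24 *
      (1 / 4 - 5 / 2 * (z - 1) ^ 2 + 5 * (z - 1) ^ 3 - 35 / 4 * (z - 1) ^ 4 +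
        5 * (z - 1) ^ 5)) := by
    intro z h1 h2
    rw [curvature_eq_of_mem_Ico (K := 1) (by norm_num) (by simpa) (by push_cast; linarith)]
    norm_num [Finset.sum_range_succ, Nat.choose]
    ring
  have e2 : ∀ z : ℝ, 2 ≤ z → z < 3 → curvature 2 z = 24 *
      (1 - 10 * (z - 2) ^ 2 + 20 * (z - 2) ^ 3 - 45 / 2 * (z - 2) ^ 4 + 10 * (z - 2) ^ 5) := by
    intro z h1 h2
    rw [curvature_eq_of_mem_Ico (K := 2) (by norm_num) (by simpa) (by push_cast; linarith)]
    norm_num [Finset.sum_range_succ, Nat.choose]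
    ring
  obtain ⟨ρ, hρ1, hρ2, hpos, hneg⟩ := exists_sign_change
    (.C (1 / 4) - .C (5 / 2) * .X ^ 2 + .C 5 * .X ^ 3 - .C (35 / 4) * .X ^ 4 + .C 5 * .X ^ 5)
    (l := 0) (u := 1) (by norm_num) (by
      intro w h1 h2
      have h3 : 0 < 1 - w := by linarith
      have key : 0 < 5 * w * (1 - w) * ((1 - w) ^ 2 + 4 * w ^ 2) := by positivity
      simp
      nlinarith) (by norm_num) (by norm_num)
  obtain ⟨τ, hτ1, hτ2, hpos', hneg'⟩ := exists_sign_change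
    (.C 1 - .C 10 * .X ^ 2 + .C 20 * .X ^ 3 - .C (45 / 2) * .X ^ 4 + .C 10 * .X ^ 5)
    (l := 0) (u := 1) (by norm_num) (by
      intro w h1 h2
      have h3 : 0 < 1 - w := by linarith
      have key : 0 < 10 * w * (1 - w) * (2 * (1 - w) ^ 2 + 3 * w ^ 2) := by positivity
      simp
      nlinarith) (by norm_num) (by norm_num)
  simp only [Polynomial.eval_sub, Polynomial.eval_add, Polynomial.eval_mul, Polynomial.eval_C,
    Polynomial.eval_X, Polynomial.eval_pow] at hpos hneg hpos' hneg'
  refine ⟨1 + ρ, 2 + τ, by linarith, by linarith, by linarith, fun z h0 h1 => ?_,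
    fun z h0 h1 => ?_, fun z h0 h1 => ?_⟩
  · rcases lt_or_ge z 1 with hz | hz
    · exact curvature_first_piece_neg 2 h0 hz (by norm_num; linarith)
    · rw [e1 z hz (by linarith), neg_lt_zero]
      exact mul_pos (by norm_num) (hpos _ (by linarith) (by linarith))
  · rcases lt_or_ge z 2 with hz | hz
    · rw [e1 z (by linarith) hz, neg_pos]
      exact mul_neg_of_pos_of_neg (by norm_num) (hneg _ (by linarith) (by linarith))
    · rw [e2 z hz (by linarith)]
      exact mul_pos (by norm_num) (hpos' _ (by linarith) (by linarith))
  · rw [e2 z (by linarith) h1]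
    exact mul_neg_of_pos_of_neg (by norm_num) (hneg' _ (by linarith) (by linarith))

theorem changesSignTwice_curvature_three : ChangesSignTwice (curvature 3) (7 / 2) := by
  have e1 : ∀ z : ℝ, 1 ≤ z → z < 2 → curvature 3 z = -(28 *
      (1 / 2 + 3 / 2 * (z - 1) - 5 * (z - 1) ^ 3 + 15 / 2 * (z - 1) ^ 4 -
        12 * (z - 1) ^ 5 + 6 * (z - 1) ^ 6)) := by
    intro z h1 h2
    rw [curvature_eq_of_mem_Ico (K := 1) (by norm_num) (by simpa) (by push_cast; linarith)]
    norm_num [Finset.sum_range_succ, Nat.choose]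
    ring
  have e2 : ∀ z : ℝ, 2 ≤ z → z < 3 → curvature 3 z = 28 *
      (3 / 2 + 15 / 2 * (z - 2) - 25 * (z - 2) ^ 3 + 75 / 2 * (z - 2) ^ 4 -
        75 / 2 * (z - 2) ^ 5 + 15 * (z - 2) ^ 6) := by
    intro z h1 h2
    rw [curvature_eq_of_mem_Ico (K := 2) (by norm_num) (by simpa) (by push_cast; linarith)]
    norm_num [Finset.sum_range_succ, Nat.choose]
    ring
  have e3 : ∀ z : ℝ, 3 ≤ z → z < 4 → curvature 3 z = -(28 *
      (1 + 15 * (z - 3) - 50 * (z - 3) ^ 3 + 75 * (z - 3) ^ 4 -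
        60 * (z - 3) ^ 5 + 20 * (z - 3) ^ 6)) := by
    intro z h1 h2
    rw [curvature_eq_of_mem_Ico (K := 3) (by norm_num) (by simpa) (by push_cast; linarith)]
    norm_num [Finset.sum_range_succ, Nat.choose]
    ring
  obtain ⟨ρ, hρ1, hρ2, hpos, hneg⟩ := exists_sign_change
    (.C (1 / 2) + .C (3 / 2) * .X - .C 5 * .X ^ 3 + .C (15 / 2) * .X ^ 4 - .C 12 * .X ^ 5 +
      .C 6 * .X ^ 6)
    (l := 1 / 2) (u := 1) (by norm_num) (by
      intro w h1 h2
      have key : ∀ a b : ℝ, 0 < a → 0 < b → 0 < 9 / 8 * b ^ 5 + 45 / 4 * a * b ^ 4 +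
          75 / 2 * a ^ 2 * b ^ 3 + 225 / 4 * a ^ 3 * b ^ 2 + 75 / 2 * a ^ 4 * b +
          15 / 2 * a ^ 5 := by
        intros; positivity
      have := key (w - 1 / 2) (1 - w) (by linarith) (by linarith)
      simp
      nlinarith) (by norm_num) (by norm_num)
  obtain ⟨τ, hτ1, hτ2, hpos', hneg'⟩ := exists_sign_change
    (.C (3 / 2) + .C (15 / 2) * .X - .C 25 * .X ^ 3 + .C (75 / 2) * .X ^ 4 -
      .C (75 / 2) * .X ^ 5 + .C 15 * .X ^ 6)
    (l := 1 / 2) (u := 1) (by norm_num) (by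
      intro w h1 h2
      have key : ∀ a b : ℝ, 0 < a → 0 < b → 0 < 45 / 32 * b ^ 5 + 135 / 32 * 5 * a * b ^ 4 +
          75 * a ^ 2 * b ^ 3 + 225 / 2 * a ^ 3 * b ^ 2 + 75 * a ^ 4 * b +
          15 * a ^ 5 := by
        intros; positivity
      have := key (w - 1 / 2) (1 - w) (by linarith) (by linarith)
      simp
      nlinarith) (by norm_num) (by norm_num)
  simp only [Polynomial.eval_sub, Polynomial.eval_add, Polynomial.eval_mul, Polynomial.eval_C,
    Polynomial.eval_X, Polynomial.eval_pow] at hpos hneg hpos' hneg'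
  refine ⟨1 + ρ, 2 + τ, by linarith, by linarith, by linarith, fun z h0 h1 => ?_,
    fun z h0 h1 => ?_, fun z h0 h1 => ?_⟩
  · rcases lt_or_ge z 1 with hz | hz
    · exact curvature_first_piece_neg 3 h0 hz (by norm_num; linarith)
    · rw [e1 z hz (by linarith), neg_lt_zero]
      refine mul_pos (by norm_num) ?_
      rcases lt_or_ge (z - 1) (1 / 2) with hw | hw
      · have key : ∀ a b : ℝ, 0 ≤ a → 0 < b → 0 < 1 / 2 * b ^ 6 + 5 / 8 * 6 * a * b ^ 5 +
            3 / 4 * 15 * a ^ 2 * b ^ 4 + 27 / 32 * 20 * a ^ 3 * b ^ 3 +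
            29 / 32 * 15 * a ^ 4 * b ^ 2 + 29 / 32 * 6 * a ^ 5 * b + 13 / 16 * a ^ 6 := by
          intros; positivity
        have := key (z - 1) (1 / 2 - (z - 1)) (by linarith) (by linarith)
        nlinarith
      · exact hpos _ (by linarith) (by linarith)
  · rcases lt_or_ge z 2 with hz | hz
    · rw [e1 z (by linarith) hz, neg_pos]
      exact mul_neg_of_pos_of_neg (by norm_num) (hneg _ (by linarith) (by linarith))
    · rw [e2 z hz (by linarith)]
      refine mul_pos (by norm_num) ?_
      rcases lt_or_ge (z - 2) (1 / 2) with hw | hw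
      · have key : ∀ a b : ℝ, 0 ≤ a → 0 < b → 0 < 3 / 2 * b ^ 6 + 17 / 8 * 6 * a * b ^ 5 +
            11 / 4 * 15 * a ^ 2 * b ^ 4 + 103 / 32 * 20 * a ^ 3 * b ^ 3 +
            113 / 32 * 15 * a ^ 4 * b ^ 2 + 467 / 128 * 6 * a ^ 5 * b + 113 / 32 * a ^ 6 := by
          intros; positivity
        have := key (z - 2) (1 / 2 - (z - 2)) (by linarith) (by linarith)
        nlinarith
      · exact hpos' _ (by linarith) (by linarith)
  · rcases lt_or_ge z 3 with hz | hz
    · rw [e2 z (by linarith) hz]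
      exact mul_neg_of_pos_of_neg (by norm_num) (hneg' _ (by linarith) (by linarith))
    · rw [e3 z hz (by linarith), neg_lt_zero]
      refine mul_pos (by norm_num) ?_
      have key : ∀ a b : ℝ, 0 ≤ a → 0 < b → 0 < 1 * b ^ 6 + 9 / 4 * 6 * a * b ^ 5 +
          7 / 2 * 15 * a ^ 2 * b ^ 4 + 71 / 16 * 20 * a ^ 3 * b ^ 3 +
          81 / 16 * 15 * a ^ 4 * b ^ 2 + 43 / 8 * 6 * a ^ 5 * b + 43 / 8 * a ^ 6 := by
        intros; positivity
      have := key (z - 3) (1 / 2 - (z - 3)) (by linarith) (by linarith)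
      nlinarith

/-- The deviation of `|a|`, rescaled to have coordinate average `1`, from the diagonal `(1, …, 1)`.
It vanishes for `a = 0`. -/
noncomputable def deviation {d : ℕ} (a : EuclideanSpace ℝ (Fin d)) (i : Fin d) : ℝ :=
  d * |a i| / ∑ j, |a j| - (∑ j, |a j|) / ∑ j, |a j|

theorem sum_deviation {d : ℕ} (a : EuclideanSpace ℝ (Fin d)) : ∑ i, deviation a i = 0 := by
  unfold deviation
  rw [Finset.sum_sub_distrib, ← Finset.sum_div, ← Finset.mul_sum]
  simp [mul_div_assoc]

theorem deviation_eq_zero {d : ℕ} {a : EuclideanSpace ℝ (Fin d)} {c : ℝ} (h : ∀ i, |a i| = c)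
    (i : Fin d) : deviation a i = 0 := by
  simp [deviation, h]

theorem abs_eq_mul_one_add_deviation {d : ℕ} [NeZero d] {a : EuclideanSpace ℝ (Fin d)}
    (ha : 0 < ∑ j, |a j|) (i : Fin d) : |a i| = (∑ j, |a j|) / d * (1 + deviation a i) := by
  have hd : (d : ℝ) ≠ 0 := Nat.cast_ne_zero.2 (NeZero.ne d)
  unfold deviation
  rw [div_self ha.ne']
  field_simp
  ring

theorem tendsto_deviation {d : ℕ} {a : EuclideanSpace ℝ (Fin d)} {c : ℝ}
    (h : ∀ i, |a i| = c) (ha : ∑ j, |a j| ≠ 0) (i : Fin d) :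
    Tendsto (fun x => deviation x i) (𝓝 a) (𝓝 0) := by
  rw [← deviation_eq_zero h i]
  have h1 : Continuous fun x : EuclideanSpace ℝ (Fin d) => ∑ j, |x j| := by fun_prop
  have h2 : Continuous fun x : EuclideanSpace ℝ (Fin d) => (d : ℝ) * |x i| := by fun_prop
  exact (h2.continuousAt.div h1.continuousAt ha).sub (h1.continuousAt.div h1.continuousAt ha)

theorem altSum_posPow_mul {d : ℕ} (n : ℕ) {r : ℝ} (hr : 0 < r) (u : Fin d → ℝ) (s : ℝ) :
    altSum (posPow n) (fun i => r * u i) (r * s) = r ^ n * altSum (posPow n) u s := by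
  unfold altSum
  rw [Finset.mul_sum]
  refine Finset.sum_congr rfl fun T _ => ?_
  rw [← Finset.mul_sum, ← mul_sub, posPow_mul n hr]
  ring

theorem sum_abs_sq_eq_one {d : ℕ} {a : EuclideanSpace ℝ (Fin d)} (ha : ‖a‖ = 1) :
    ∑ i, |a i| ^ 2 = 1 := by
  have := EuclideanSpace.norm_sq_eq a
  rw [ha] at this
  simpa using this.symm

theorem sectionVolume_eq_deviation {m : ℕ} {a : EuclideanSpace ℝ (Fin (m + 4))} (ha : ‖a‖ = 1)
    (hpos : ∀ i, a i ≠ 0) (t : ℝ) :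
    sectionVolume (m + 4) t a ≠ ⊤ ∧ 0 < ∏ i, (1 + deviation a i) ∧
      (sectionVolume (m + 4) t a).toReal * ((m + 3).factorial * ∏ i, (1 + deviation a i)) =
        √(m + 4 + ∑ i, deviation a i ^ 2) *
          altSum (posPow (m + 3)) (fun i => 1 + deviation a i)
            ((m + 4) / 2 - t * √(m + 4 + ∑ i, deviation a i ^ 2)) := by
  have hσ : 0 < ∑ j, |a j| :=
    Finset.sum_pos (fun i _ => abs_pos.2 (hpos i)) Finset.univ_nonempty
  have hd : (0 : ℝ) < m + 4 := by positivity
  have hu := abs_eq_mul_one_add_deviation hσ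
  push_cast at hu
  set r : ℝ := (∑ j, |a j|) / (m + 4) with hr
  have hr0 : 0 < r := div_pos hσ hd
  have hu0 : ∀ i, 0 < 1 + deviation a i := fun i => by
    have := abs_pos.2 (hpos i)
    rw [hu i] at this
    exact (mul_pos_iff_of_pos_left hr0).1 this
  have hsum := sum_deviation a
  set h := deviation a with hh
  have hsq : r ^ 2 * (m + 4 + ∑ i, h i ^ 2) = 1 := by
    rw [← sum_abs_sq_eq_one ha]
    simp only [hu, mul_pow]
    rw [← Finset.mul_sum]
    simp only [add_sq, Finset.sum_add_distrib, ← Finset.mul_sum, mul_one, hsum]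
    simp
  have hsqrt : √(m + 4 + ∑ i, h i ^ 2) = 1 / r := by
    have : m + 4 + ∑ i, h i ^ 2 = (1 / r) ^ 2 := by
      field_simp
      linarith
    rw [this, Real.sqrt_sq (by positivity)]
  obtain ⟨h1, h2⟩ := sectionVolume_eq (n := m + 3) (by omega) (WithLp.toLp 2 fun i => |a i|)
    (by
      rw [EuclideanSpace.norm_eq]
      simp only [Real.norm_eq_abs, abs_abs]
      rw [sum_abs_sq_eq_one ha, Real.sqrt_one]) (fun i => abs_pos.2 (hpos i)) t
  rw [sectionVolume_abs] at h1 h2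
  have hprod : 0 < ∏ i, (1 + h i) := Finset.prod_pos fun i _ => hu0 i
  refine ⟨h1, hprod, ?_⟩
  rw [h2, hsqrt]
  have e1 : (∑ i, |a i|) / 2 - t = r * ((m + 4) / 2 - t * (1 / r)) := by
    rw [show ∑ i, |a i| = r * (m + 4) by rw [hr]; field_simp]
    field_simp
  have e2 : (fun i => |a i|) = fun i => r * (1 + h i) := funext hu
  have e3 : ∏ i, |a i| = r ^ (m + 4) * ∏ i, (1 + h i) := by
    simp only [hu, Finset.prod_mul_distrib]
    simp
  simp only [e1, e3]
  rw [e2, altSum_posPow_mul _ hr0]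
  have hf : ((m + 3).factorial : ℝ) ≠ 0 := Nat.cast_ne_zero.2 (Nat.factorial_ne_zero _)
  have hp := hprod.ne'
  field_simp
  ring

theorem exists_abs_eq_of_isDiagonalDirection {d : ℕ} {a : EuclideanSpace ℝ (Fin d)}
    (ha : ‖a‖ = 1) (hdiag : IsDiagonalDirection a) : ∃ c : ℝ, 0 < c ∧ ∀ i, |a i| = c := by
  obtain ⟨v, w, hvw, c, rfl⟩ := hdiag
  refine ⟨|c|, abs_pos.2 ?_, fun i => ?_⟩
  · rintro rfl
    simp at ha
  · rcases hvw i with ⟨h1, h2⟩ | ⟨h1, h2⟩ <;> simp [h1, h2]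

theorem eq_of_deviation_eq_zero {d : ℕ} [NeZero d] {a x : EuclideanSpace ℝ (Fin d)} {c : ℝ}
    (hc : 0 < c) (hac : ∀ i, |a i| = c) (ha : ‖a‖ = 1) (hx : ‖x‖ = 1) (hxa : ∀ i, 0 < x i * a i)
    (h : ∑ i, deviation x i ^ 2 = 0) : x = a := by
  have hdev : ∀ i, deviation x i = 0 := fun i => by
    have := (Finset.sum_eq_zero_iff_of_nonneg fun i _ => sq_nonneg (deviation x i)).1 h i
      (Finset.mem_univ i)
    simpa using this
  have hx0 : ∀ i, 0 < |x i| := fun i => abs_pos.2 fun h0 => by simpa [h0] using hxa i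
  have hσ : 0 < ∑ j, |x j| := Finset.sum_pos (fun i _ => hx0 i) Finset.univ_nonempty
  set r := (∑ j, |x j|) / d with hr
  have hxr : ∀ i, |x i| = r := fun i => by
    simpa [hdev i] using abs_eq_mul_one_add_deviation hσ i
  have hd : (d : ℝ) ≠ 0 := Nat.cast_ne_zero.2 (NeZero.ne d)
  have hr0 : 0 < r := (hxr 0) ▸ hx0 0
  have h1 := sum_abs_sq_eq_one ha
  have h2 := sum_abs_sq_eq_one hx
  simp only [hac, hxr, Finset.sum_const, Finset.card_univ, Fintype.card_fin, nsmul_eq_mul] at h1 h2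
  have hrc : r = c := by
    have h3 : r ^ 2 = c ^ 2 := mul_left_cancel₀ hd (h2.trans h1.symm)
    exact (pow_left_inj₀ hr0.le hc.le two_ne_zero).1 h3
  ext i
  rcases abs_eq_abs.1 ((hxr i).trans (hrc.trans (hac i).symm)) with h3 | h3
  · exact h3
  · have := hxa i
    rw [h3] at this
    nlinarith [sq_nonneg (a i)]

/-- Near a diagonal, the sign of the change of the section volume is that of `curvature`. -/
theorem eventually_sectionVolume_compare {m : ℕ} {a : EuclideanSpace ℝ (Fin (m + 4))}
    (ha : ‖a‖ = 1) (hdiag : IsDiagonalDirection a) (t : ℝ) :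
    (curvature m ((m + 4) / 2 - t * √(m + 4)) < 0 →
      ∀ᶠ x in 𝓝[Metric.sphere 0 1 \ {a}] a, sectionVolume (m + 4) t x < sectionVolume (m + 4) t a) ∧
    (0 < curvature m ((m + 4) / 2 - t * √(m + 4)) →
      ∀ᶠ x in 𝓝[Metric.sphere 0 1 \ {a}] a,
        sectionVolume (m + 4) t a < sectionVolume (m + 4) t x) := by
  obtain ⟨c, hc, hac⟩ := exists_abs_eq_of_isDiagonalDirection ha hdiag
  have ha0 : ∀ i, a i ≠ 0 := fun i => abs_pos.1 (by rw [hac i]; exact hc)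
  have hσ : ∑ j, |a j| ≠ 0 :=
    (Finset.sum_pos (fun i _ => abs_pos.2 (ha0 i)) Finset.univ_nonempty).ne'
  set l := 𝓝[Metric.sphere 0 1 \ {a}] a with hl
  have hdev : ∀ i, Tendsto (fun x => deviation x i) l (𝓝 0) := fun i =>
    (tendsto_deviation hac hσ i).mono_left nhdsWithin_le_nhds
  have hsign : ∀ᶠ x in l, ∀ i, 0 < x i * a i := by
    refine eventually_all.2 fun i => ?_
    have h1 : Continuous fun x : EuclideanSpace ℝ (Fin (m + 4)) => x i * a i := by fun_prop
    have h2 : 0 < a i * a i := mul_self_pos.2 (ha0 i)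
    exact nhdsWithin_le_nhds (h1.continuousAt.eventually (lt_mem_nhds h2))
  have hmem : ∀ᶠ x in l, x ∈ Metric.sphere (0 : EuclideanSpace ℝ (Fin (m + 4))) 1 \ {a} :=
    self_mem_nhdsWithin
  have hO := isLittleO_section hdev sum_deviation t
  set κ := curvature m ((m + 4) / 2 - t * √(m + 4)) with hκ
  set C : ℝ := √(m + 4) / (4 * (m + 4)) with hC
  have hC0 : 0 < C := by positivity
  obtain ⟨hta, -, hva⟩ := sectionVolume_eq_deviation ha ha0 t
  simp only [deviation_eq_zero hac, add_zero, Finset.prod_const_one, mul_one, ne_eq,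
    OfNat.ofNat_ne_zero, not_false_eq_true, zero_pow, Finset.sum_const_zero] at hva
  have hf : (0 : ℝ) < (m + 3).factorial := Nat.cast_pos.2 (Nat.factorial_pos _)
  have hmain : κ ≠ 0 → ∀ᶠ x in l, sectionVolume (m + 4) t x ≠ ⊤ ∧ ∃ p q : ℝ, 0 < p ∧ 0 < q ∧
      |((sectionVolume (m + 4) t x).toReal - (sectionVolume (m + 4) t a).toReal) * p -
        C * κ * q| ≤ |C * κ| / 2 * q := by
    intro hκ0
    have h1 := isLittleO_iff.1 hO (half_pos (abs_pos.2 (mul_ne_zero hC0.ne' hκ0)))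
    filter_upwards [h1, hsign, hmem] with x hx hxa ⟨hxS, hxne⟩
    have hxn : ‖x‖ = 1 := by simpa using hxS
    have hx0 : ∀ i, x i ≠ 0 := fun i h0 => by simpa [h0] using hxa i
    obtain ⟨htx, hpx, hvx⟩ := sectionVolume_eq_deviation hxn hx0 t
    have hq0 : 0 ≤ ∑ i, deviation x i ^ 2 := Finset.sum_nonneg fun _ _ => sq_nonneg _
    have hq : 0 < ∑ i, deviation x i ^ 2 := lt_of_le_of_ne hq0 fun h =>
      hxne (eq_of_deviation_eq_zero hc hac ha hxn hxa h.symm)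
    refine ⟨htx, (m + 3).factorial * ∏ i, (1 + deviation x i), _, by positivity, hq, ?_⟩
    rw [Real.norm_eq_abs, Real.norm_of_nonneg hq0, ← hvx, ← hva] at hx
    refine le_of_eq_of_le ?_ hx
    congr 1
    ring
  constructor
  · intro hneg
    filter_upwards [hmain hneg.ne] with x ⟨htx, p, q, hp, hq, hx⟩
    rw [← ENNReal.toReal_lt_toReal htx hta]
    have h1 : C * κ < 0 := mul_neg_of_pos_of_neg hC0 hneg
    rw [abs_of_neg h1] at hx
    have h2 := (abs_le.1 hx).2
    have h3 := mul_neg_of_neg_of_pos h1 hq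
    by_contra! h4
    have := mul_nonneg (sub_nonneg.2 h4) hp.le
    linarith
  · intro hpos
    filter_upwards [hmain hpos.ne'] with x ⟨htx, p, q, hp, hq, hx⟩
    rw [← ENNReal.toReal_lt_toReal hta htx]
    have h1 : 0 < C * κ := mul_pos hC0 hpos
    rw [abs_of_pos h1] at hx
    have h2 := (abs_le.1 hx).1
    have h3 := mul_pos h1 hq
    by_contra! h4
    have := mul_nonneg (sub_nonneg.2 h4) hp.le
    linarith

theorem strictLocalMaxAtDiagonals_of_curvature_neg {m : ℕ} {t : ℝ}
    (h : curvature m ((m + 4) / 2 - t * √(m + 4)) < 0) : StrictLocalMaxAtDiagonals (m + 4) t :=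
  fun _ ha hdiag => ⟨by simpa using ha, (eventually_sectionVolume_compare ha hdiag t).1 h⟩

theorem strictLocalMinAtDiagonals_of_curvature_pos {m : ℕ} {t : ℝ}
    (h : 0 < curvature m ((m + 4) / 2 - t * √(m + 4))) : StrictLocalMinAtDiagonals (m + 4) t :=
  fun _ ha hdiag => ⟨by simpa using ha, (eventually_sectionVolume_compare ha hdiag t).2 h⟩

theorem changesSignTwice_curvature {m : ℕ} (hm : m ≤ 3) :
    ChangesSignTwice (curvature m) ((m + 4) / 2) := by
  interval_cases m
  · convert changesSignTwice_curvature_zero using 1; norm_num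
  · convert changesSignTwice_curvature_one using 1; norm_num
  · convert changesSignTwice_curvature_two using 1; norm_num
  · convert changesSignTwice_curvature_three using 1; norm_num

end HypercubeSection

theorem mainTheorem8 (d : ℕ) (hd4 : 4 ≤ d) (hd7 : d ≤ 7) :
    ∃ ρp ρm : ℝ, 0 < ρp ∧ ρp < ρm ∧ ρm < (d : ℝ) / 2 ∧
      (∀ t ∈ Set.Ioo (0 : ℝ) (√(d : ℝ) / 2 - ρm / √(d : ℝ)) ∪
          Set.Ioo (√(d : ℝ) / 2 - ρp / √(d : ℝ)) (√(d : ℝ) / 2),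
        HypercubeSection.StrictLocalMaxAtDiagonals d t) ∧
      (∀ t ∈ Set.Ioo (√(d : ℝ) / 2 - ρm / √(d : ℝ)) (√(d : ℝ) / 2 - ρp / √(d : ℝ)),
        HypercubeSection.StrictLocalMinAtDiagonals d t) := by
  obtain ⟨m, rfl⟩ := Nat.exists_eq_add_of_le' hd4
  obtain ⟨p, q, hp, hpq, hq, h1, h2, h3⟩ :=
    HypercubeSection.changesSignTwice_curvature (m := m) (by omega)
  push_cast
  have hd : (0 : ℝ) < m + 4 := by positivity
  have hr0 : 0 < √((m : ℝ) + 4) := Real.sqrt_pos.2 hd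
  have hr2 : √((m : ℝ) + 4) * √((m : ℝ) + 4) = m + 4 := Real.mul_self_sqrt hd.le
  have hlt : ∀ t s : ℝ, t < √((m : ℝ) + 4) / 2 - s / √((m : ℝ) + 4) ↔
      s < (m + 4) / 2 - t * √((m : ℝ) + 4) := by
    intro t s
    rw [lt_sub_comm, div_lt_iff₀ hr0, sub_mul, div_mul_eq_mul_div, hr2]
  have hgt : ∀ t s : ℝ, √((m : ℝ) + 4) / 2 - s / √((m : ℝ) + 4) < t ↔
      (m + 4) / 2 - t * √((m : ℝ) + 4) < s := by
    intro t s
    rw [sub_lt_comm, lt_div_iff₀ hr0, sub_mul, div_mul_eq_mul_div, hr2]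
  refine ⟨p, q, hp, hpq, hq, ?_, ?_⟩
  · rintro t (⟨ht0, ht⟩ | ⟨ht, ht1⟩)
    · refine HypercubeSection.strictLocalMaxAtDiagonals_of_curvature_neg
        (h3 _ ((hlt t q).1 ht) ?_)
      linarith [mul_pos ht0 hr0]
    · refine HypercubeSection.strictLocalMaxAtDiagonals_of_curvature_neg
        (h1 _ ((hlt t 0).1 ?_) ((hgt t p).1 ht))
      simpa using ht1
  · rintro t ⟨ht, ht'⟩
    exact HypercubeSection.strictLocalMinAtDiagonals_of_curvature_pos
      (h2 _ ((hlt t p).1 ht') ((hgt t q).1 ht))
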